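/- Let $K$ be a field, $R=K[x_1,\dots,x_n]$ with a monomial order $<$, and let $f_1,\dots,f_m\in R$ be homogeneous polynomials forming a regular sequence ($f_i$ is a non-zero-divisor on $R/\langle f_1,\dots,f_{i-1}\rangle$ for $i=1,\dots,m$, and $\langle f_1,\dots,f_m\rangle\ne R$). For $\alpha=\sum a_i e_i\in R^m$ put $\bar\alpha=\sum a_if_i$; $\alpha$ is a syzygy if $\bar\alpha=0$. Order module monomials by $a e_i<_{\mathrm{d\text{-}pot}} b e_j$ iff $\deg(\overline{ae_i})<\deg(\overline{be_j})$, or these degrees are equal and either $i<j$, or $i=j$ and $a<b$. For $\alpha\neq 0$ the signature $\mathrm{sig}(\alpha)$ is the largest term of $\alpha$; if it is a multiple of $e_i$, then $i$ is the index of $\alpha$. Signatures are compared and divided up to non-zero scalars. The S-pair of $\alpha,\beta$ (with $\bar\alpha,\bar\beta\ne0$) is $\frac{\lambda}{\mathrm{lt}(\bar\alpha)}\alpha-\frac{\lambda}{\mathrm{lt}(\bar\beta)}\beta$, $\lambda=\mathrm{lcm}(\mathrm{lt}(\bar\alpha),\mathrm{lt}(\bar\beta))$; the two summands (up to sign) are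 its generators, and it is regular if their signatures differ. A regular s-reduction step of $\alpha$ by $\beta\in G$ replaces $\alpha$ by $\alpha-b\beta$, where $b$ is a monomial such that $\mathrm{lt}(\overline{b\beta})$ is a term of $\bar\alpha$ and $\mathrm{sig}(b\beta)<\mathrm{sig}(\alpha)$. A result of regular s-reducing $\alpha$ is an element reached from $\alpha$ by such steps that admits no further one. Algorithm RB starts with $G=\emptyset$, $H=\{f_ie_j-f_je_i: i<j\}$, $P=\{e_1,\dots,e_m\}$ and proceeds as follows, as long as $P\neq\emptyset$. (a) Whenever the degree $\deg(\overline{T})$ of the minimal signature $T$ in $P$ exceeds the degree treated so far, a new degree step starts, and the Koszul syzygies $\bar\alpha e_k-f_k\alpha$, for all $\alpha\in G$ and all $k$ larger than the index of $\alpha$, are added to $H$. (b) An element $p$ of $P$ of minimal signature (ties broken arbitrarily) is removed from $P$. It is discarded if it is rewritable. Otherwise it is regular s-reduced with respect to $G$ to a result $\gamma$. If $\bar\gamma=0$, then $\gamma$ is added to $H$; otherwise the regular S-pairs of $\gamma$ with the elements of $G$ are added to $P$, and $\gamma$ is added to $G$. Here an S-pair is rewritable if one of its two generators $a\alpha$ is,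 which means that there is $\gamma\in G\cup H$, $\gamma\neq\alpha$, with $\mathrm{sig}(\gamma)\mid\mathrm{sig}(a\alpha)$ and $\alpha\trianglelefteq\gamma$; a unit vector $e_i$ is rewritable if $\mathrm{sig}(\gamma)\mid e_i$ for some $\gamma\in G\cup H$. The rewrite order $\trianglelefteq$ is a partial order on $G\cup H$, total on $G$, fixed during the computation, such that $\alpha\trianglelefteq\sigma$ for $\alpha\in G$, $\sigma\in H$, and such that $\alpha\trianglelefteq\beta$ whenever $\alpha,\beta\in G$, $\mathrm{sig}(\alpha)$ properly divides $\mathrm{sig}(\beta)$, and $\mathrm{sig}(\alpha)\,\mathrm{lt}(\bar\beta)\le\mathrm{sig}(\beta)\,\mathrm{lt}(\bar\alpha)$ (these are then multiples of the same $e_i$ and are compared by $<$ on the coefficient monomials). Both usual rewrite orders, $\trianglelefteq_{\mathrm{add}}$ (later added elements are larger) and $\trianglelefteq_{\mathrm{rat}}$ (larger ratio $\mathrm{sig}(\alpha)/\mathrm{lt}(\bar\alpha)$, ties by signature), are of this kind. Then RB performs no s-reduction to zero: at every point of every such computation, for every element of $P$ that is chosen and not discarded, every result $\gamma$ of its regular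 s-reduction satisfies $\bar\gamma\neq0$. -/

import Mathlib

open scoped MonomialOrder

namespace SigGB

variable {K : Type*} [Field K] {n m : ℕ}

/-- Monic module monomials `x^a e_i` of the free module `K[x_1,…,x_n]^m`, as pairs `(i, a)`. -/
abbrev ModMon (n m : ℕ) : Type := Fin m × (Fin n →₀ ℕ)

/-- The free module `K[x_1,…,x_n]^m`. -/
abbrev FreeMod (K : Type*) [Field K] (n m : ℕ) : Type _ := Fin m → MvPolynomial (Fin n) K

/-- The unit vector `e_i`. -/
noncomputable def unitVec (i : Fin m) : FreeMod K n m := Pi.single i 1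

/-- The homomorphism `α ↦ ᾱ`, sending `e_i` to `f_i`. -/
noncomputable def proj (f : Fin m → MvPolynomial (Fin n) K) (α : FreeMod K n m) :
    MvPolynomial (Fin n) K := ∑ i, α i * f i

/-- `T` divides `U`, as module monomials. -/
def ModDvd (T U : ModMon n m) : Prop := T.1 = U.1 ∧ T.2 ≤ U.2

/-- The degree of the image in the polynomial ring of the module monomial `x^a e_i`. -/
noncomputable def sigDegree (f : Fin m → MvPolynomial (Fin n) K) (T : ModMon n m) : ℕ :=
  (proj f (MvPolynomial.monomial T.2 (1 : K) • unitVec T.1)).totalDegree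

/-- The position-over-term order. -/
def PotLT (mo : MonomialOrder (Fin n)) (T U : ModMon n m) : Prop :=
  T.1 < U.1 ∨ (T.1 = U.1 ∧ T.2 ≺[mo] U.2)

/-- The degree-then-position order: compare the degrees of the images, break ties by `PotLT`. -/
def DPotLT (mo : MonomialOrder (Fin n)) (f : Fin m → MvPolynomial (Fin n) K)
    (T U : ModMon n m) : Prop :=
  sigDegree f T < sigDegree f U ∨ (sigDegree f T = sigDegree f U ∧ PotLT mo T U)

/-- `T` is the signature of `α` (up to its coefficient): the largest module monomial that
occurs in `α`. An element has a signature iff it is nonzero. -/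
def HasSig (mo : MonomialOrder (Fin n)) (f : Fin m → MvPolynomial (Fin n) K)
    (α : FreeMod K n m) (T : ModMon n m) : Prop :=
  (α T.1).coeff T.2 ≠ 0 ∧
    ∀ U : ModMon n m, (α U.1).coeff U.2 ≠ 0 → U ≠ T → DPotLT mo f U T

/-- One regular s-reduction step with respect to `G`: some term of `ᾱ`, with exponent `v`, is
the lead term of the image of `b β`, where `b = c x^w` is a nonzero monomial, `β ∈ G`, and the
signature of `b β` is smaller than that of `α`. The outcome is `α - b β`. -/
def RegularStep (mo : MonomialOrder (Fin n)) (f : Fin m → MvPolynomial (Fin n) K)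
    (G : Set (FreeMod K n m)) (α α' : FreeMod K n m) : Prop :=
  ∃ β ∈ G, ∃ (w : Fin n →₀ ℕ) (c : K), c ≠ 0 ∧
    (∃ v ∈ (proj f α).support,
      mo.leadingTerm (proj f (MvPolynomial.monomial w c • β)) =
        MvPolynomial.monomial v ((proj f α).coeff v)) ∧
    (∃ S T : ModMon n m, HasSig mo f (MvPolynomial.monomial w c • β) S ∧ HasSig mo f α T ∧
      DPotLT mo f S T) ∧
    α' = α - MvPolynomial.monomial w c • β

/-- `γ` is a result of regular s-reducing `α` with respect to `G`. -/
def RegularResult (mo : MonomialOrder (Fin n)) (f : Fin m → MvPolynomial (Fin n) K)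
    (G : Set (FreeMod K n m)) (α γ : FreeMod K n m) : Prop :=
  Relation.ReflTransGen (RegularStep mo f G) α γ ∧ ¬ ∃ δ, RegularStep mo f G γ δ

/-- The monomial `λ / lt(ᾱ)`, where `λ` is the monic least common multiple of the lead terms of
`ᾱ` and of the image of `β`. -/
noncomputable def cofactor (mo : MonomialOrder (Fin n)) (f : Fin m → MvPolynomial (Fin n) K)
    (α β : FreeMod K n m) : MvPolynomial (Fin n) K :=
  MvPolynomial.monomial
    ((mo.degree (proj f α) ⊔ mo.degree (proj f β)) - mo.degree (proj f α))
    (mo.leadingCoeff (proj f α))⁻¹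

/-- The S-pair of `α` and `β` is regular: its two generators have different signatures. -/
def IsRegularPair (mo : MonomialOrder (Fin n)) (f : Fin m → MvPolynomial (Fin n) K)
    (α β : FreeMod K n m) : Prop :=
  ∃ S T : ModMon n m, HasSig mo f (cofactor mo f α β • α) S ∧
    HasSig mo f (cofactor mo f β α • β) T ∧ S ≠ T

/-- Members of the pair set: the unit vectors `e_i`, and the S-pairs. -/
inductive Pair (K : Type*) [Field K] (n m : ℕ) : Type _
  | unit (i : Fin m) : Pair K n m
  | spair (α β : FreeMod K n m) : Pair K n m

/-- The module element that a member of the pair set stands for. -/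
noncomputable def Pair.value (mo : MonomialOrder (Fin n)) (f : Fin m → MvPolynomial (Fin n) K) :
    Pair K n m → FreeMod K n m
  | .unit i => unitVec i
  | .spair α β => cofactor mo f α β • α - cofactor mo f β α • β

/-- `γ` is a rewriter in signature `T`: its signature divides `T`. -/
def IsRewriter (mo : MonomialOrder (Fin n)) (f : Fin m → MvPolynomial (Fin n) K)
    (γ : FreeMod K n m) (T : ModMon n m) : Prop :=
  ∃ S, HasSig mo f γ S ∧ ModDvd S T

/-- The multiple of `α ∈ G` whose signature is `T` is rewritable: `α` is not the maximal rewriter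
in signature `T`, with respect to the rewrite order `le` on `G ∪ H`. -/
def Rewritable (mo : MonomialOrder (Fin n)) (f : Fin m → MvPolynomial (Fin n) K)
    (le : FreeMod K n m → FreeMod K n m → Prop) (G H : Set (FreeMod K n m))
    (α : FreeMod K n m) (T : ModMon n m) : Prop :=
  ∃ γ ∈ G ∪ H, γ ≠ α ∧ le α γ ∧ IsRewriter mo f γ T

/-- The rewritability check. An S-pair is rewritable if one of its two generators is; a unit
vector is rewritable if `G ∪ H` already contains a rewriter in its signature. -/
def Pair.IsRewritable (mo : MonomialOrder (Fin n)) (f : Fin m → MvPolynomial (Fin n) K)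
    (le : FreeMod K n m → FreeMod K n m → Prop) (G H : Set (FreeMod K n m)) :
    Pair K n m → Prop
  | .unit i => ∃ γ ∈ G ∪ H, IsRewriter mo f γ (i, 0)
  | .spair α β =>
      (∃ S, HasSig mo f (cofactor mo f α β • α) S ∧ Rewritable mo f le G H α S) ∨
      (∃ S, HasSig mo f (cofactor mo f β α • β) S ∧ Rewritable mo f le G H β S)

/-- A state of RB: the basis `G`, the known syzygies `H`, the pair set `P`, and the degree step
`deg` that has been reached. -/
structure State (K : Type*) [Field K] (n m : ℕ) where
  G : Set (FreeMod K n m)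
  H : Set (FreeMod K n m)
  P : Set (Pair K n m)
  deg : ℕ

/-- The initial state: `G` is empty, `H` consists of the Koszul syzygies of the input, and `P` of
the unit vectors. -/
def initState (f : Fin m → MvPolynomial (Fin n) K) : State K n m where
  G := ∅
  H := {σ | ∃ i j : Fin m, i < j ∧ σ = f i • unitVec j - f j • unitVec i}
  P := Set.range Pair.unit
  deg := 0

/-- The Koszul syzygies `ᾱ e_k - f_k α` between the elements `α` of `G` and the unit vectors
`e_k` of index `k` larger than the index of `α`. -/
def basisKoszul (mo : MonomialOrder (Fin n)) (f : Fin m → MvPolynomial (Fin n) K)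
    (G : Set (FreeMod K n m)) : Set (FreeMod K n m) :=
  {σ | ∃ α ∈ G, ∃ S : ModMon n m, HasSig mo f α S ∧ ∃ k : Fin m, S.1 < k ∧
    σ = proj f α • unitVec k - f k • α}

/-- `p` is a member of minimal signature, namely `T`, of the pair set. -/
def IsNext (mo : MonomialOrder (Fin n)) (f : Fin m → MvPolynomial (Fin n) K)
    (s : State K n m) (p : Pair K n m) (T : ModMon n m) : Prop :=
  p ∈ s.P ∧ HasSig mo f (p.value mo f) T ∧
    ∀ q ∈ s.P, ∀ U, HasSig mo f (q.value mo f) U → ¬ DPotLT mo f U T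

/-- In state `s`, RB takes `p` out of the pair set, finds it not rewritable and regular s-reduces
it, with result `γ`. -/
def Reduces (mo : MonomialOrder (Fin n)) (f : Fin m → MvPolynomial (Fin n) K)
    (le : FreeMod K n m → FreeMod K n m → Prop) (s : State K n m)
    (p : Pair K n m) (γ : FreeMod K n m) : Prop :=
  (∃ T, IsNext mo f s p T ∧ sigDegree f T ≤ s.deg) ∧
    ¬ p.IsRewritable mo f le s.G s.H ∧ RegularResult mo f s.G (p.value mo f) γ

/-- The steps of RB. When the minimal signature in the pair set has a degree beyond the current
one, a new degree step starts and the Koszul syzygies of the current basis are added to `H`.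
Otherwise a pair of minimal signature is discarded, or reduced and its result added to `H` or to
`G`; in the last case its regular S-pairs with the elements of `G` are added to the pair set. -/
inductive Step (mo : MonomialOrder (Fin n)) (f : Fin m → MvPolynomial (Fin n) K)
    (le : FreeMod K n m → FreeMod K n m → Prop) : State K n m → State K n m → Prop
  | newDegree (s : State K n m) (p : Pair K n m) (T : ModMon n m)
      (hp : IsNext mo f s p T) (hd : s.deg < sigDegree f T) :
      Step mo f le s { s with H := s.H ∪ basisKoszul mo f s.G, deg := sigDegree f T }
  | discard (s : State K n m) (p : Pair K n m) (T : ModMon n m)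
      (hp : IsNext mo f s p T) (hd : sigDegree f T ≤ s.deg)
      (hr : p.IsRewritable mo f le s.G s.H) :
      Step mo f le s { s with P := s.P \ {p} }
  | syzygy (s : State K n m) (p : Pair K n m) (γ : FreeMod K n m)
      (hp : Reduces mo f le s p γ) (h0 : proj f γ = 0) :
      Step mo f le s { s with P := s.P \ {p}, H := s.H ∪ {γ} }
  | basis (s : State K n m) (p : Pair K n m) (γ : FreeMod K n m)
      (hp : Reduces mo f le s p γ) (h0 : proj f γ ≠ 0) :
      Step mo f le s
        { s with
          P := (s.P \ {p}) ∪ {q | ∃ α ∈ s.G, IsRegularPair mo f α γ ∧ q = Pair.spair α γ}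
          G := s.G ∪ {γ} }

/-- `le` is a rewrite order on `G ∪ H`: a partial order that is total on `G`. -/
structure IsRewriteOrder (le : FreeMod K n m → FreeMod K n m → Prop)
    (G H : Set (FreeMod K n m)) : Prop where
  refl : ∀ α ∈ G ∪ H, le α α
  antisymm : ∀ α ∈ G ∪ H, ∀ β ∈ G ∪ H, le α β → le β α → α = β
  trans : ∀ α ∈ G ∪ H, ∀ β ∈ G ∪ H, ∀ γ ∈ G ∪ H, le α β → le β γ → le α γ
  total : ∀ α ∈ G, ∀ β ∈ G, le α β ∨ le β α

/-- The rewrite orders that are considered: known syzygies are preferred to basis elements, and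
`β ∈ G` is preferred to `α ∈ G` if the signature `S` of `α` properly divides the signature `T` of
`β` and `S lt(β̄) ≤ T lt(ᾱ)`. Both usual choices are of this kind: to prefer the element that was
added later (signatures being treated in increasing order), and to prefer the element with the
larger ratio of signature and lead term (equal ratios being compared by signature). -/
structure IsAdmissibleOrder (mo : MonomialOrder (Fin n)) (f : Fin m → MvPolynomial (Fin n) K)
    (le : FreeMod K n m → FreeMod K n m → Prop) (G H : Set (FreeMod K n m)) : Prop
    extends IsRewriteOrder le G H where
  le_syzygy : ∀ α ∈ G, ∀ σ ∈ H, le α σ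
  le_of_dvd : ∀ α ∈ G, ∀ β ∈ G, ∀ S T : ModMon n m,
    HasSig mo f α S → HasSig mo f β T → ModDvd S T → S ≠ T →
    S.2 + mo.degree (proj f β) ≼[mo] T.2 + mo.degree (proj f α) → le α β

/-- The states `s 0, …, s N` form an initial segment of a computation of RB on the input `f`,
with the order `DPotLT` and the rewrite order `le`. -/
structure IsRun (mo : MonomialOrder (Fin n)) (f : Fin m → MvPolynomial (Fin n) K)
    (le : FreeMod K n m → FreeMod K n m → Prop) (N : ℕ) (s : ℕ → State K n m) : Prop where
  init : s 0 = initState f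
  step : ∀ i < N, Step mo f le (s i) (s (i + 1))
  order : ∀ i ≤ N, IsAdmissibleOrder mo f le (s i).G (s i).H

end SigGB
/-!
Below the signatures still in the pair set, the current basis `G` is a signature Gröbner basis:
this follows from a loop invariant of RB by induction on the signature. Suppose now that a pair
of signature `x^a e_k` is reduced to a syzygy `γ`. By regularity the component `γ_k`, whose lead
monomial is `x^a`, lies in `⟨f_1, …, f_{k-1}⟩`. It is homogeneous, and of smaller degree than the
current degree step because `f_k` is not a constant. So its preimages under `α ↦ ᾱ` have
signatures that have been treated, and `x^a` is divisible by `lt(β̄)` for some `β ∈ G` of index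
less than `k` that was found in an earlier degree step. The Koszul syzygy `β̄ e_k - f_k β`, of
signature `lt(β̄) e_k`, was then in `H` when the pair was chosen, and the pair was discarded.
-/

namespace SigGB

open MvPolynomial

/-! ### Regular sequences -/

section RegularSequence

open RingTheory.Sequence

variable {R : Type*} [CommRing R] {m : ℕ} {f : Fin m → R}

theorem ofList_take_ofFn (f : Fin m → R) (k : Fin m) :
    Ideal.ofList ((List.ofFn f).take k) = Ideal.span (f '' Set.Iio k) := by
  rw [Ideal.ofList]
  congr 1
  ext r
  simp only [Set.mem_ofPred_eq, List.mem_take_iff_getElem, List.length_ofFn, List.getElem_ofFn,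
    Set.mem_image, Set.mem_Iio, Fin.lt_def]
  constructor
  · rintro ⟨i, hi, rfl⟩
    exact ⟨⟨i, by omega⟩, by dsimp only; omega, rfl⟩
  · rintro ⟨i, hi, rfl⟩
    exact ⟨i, by omega, rfl⟩

theorem mem_span_of_isRegular_of_mul_mem (hreg : IsRegular R (List.ofFn f)) {k : Fin m} {r : R}
    (h : r * f k ∈ Ideal.span (f '' Set.Iio k)) : r ∈ Ideal.span (f '' Set.Iio k) := by
  have hk := hreg.regular_mod_prev k (by simp)
  rw [List.getElem_ofFn, smul_eq_mul, Ideal.mul_top, ofList_take_ofFn] at hk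
  refine (Submodule.Quotient.mk_eq_zero _).1 (hk.right_eq_zero_of_smul ?_)
  rwa [← Submodule.Quotient.mk_smul, Submodule.Quotient.mk_eq_zero, smul_eq_mul, mul_comm]

theorem span_range_ne_top_of_isRegular (hreg : IsRegular R (List.ofFn f)) :
    Ideal.span (Set.range f) ≠ ⊤ := by
  have h := hreg.top_ne_smul
  have hrange : {r | r ∈ List.ofFn f} = Set.range f := by ext; simp [List.mem_ofFn]
  rw [smul_eq_mul, Ideal.mul_top, Ideal.ofList, hrange] at h
  exact h.symm

theorem not_isUnit_of_isRegular (hreg : IsRegular R (List.ofFn f)) (k : Fin m) :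
    ¬ IsUnit (f k) := fun h =>
  span_range_ne_top_of_isRegular hreg (Ideal.eq_top_of_isUnit_mem _ (Ideal.subset_span ⟨k, rfl⟩) h)

theorem ne_zero_of_isRegular (hreg : IsRegular R (List.ofFn f)) (k : Fin m) : f k ≠ 0 := by
  intro h0
  have h1 : (1 : R) ∈ Ideal.span (f '' Set.Iio k) :=
    mem_span_of_isRegular_of_mul_mem hreg (by rw [h0, mul_zero]; exact Ideal.zero_mem _)
  exact span_range_ne_top_of_isRegular hreg ((Ideal.eq_top_iff_one _).2
    (Ideal.span_mono (Set.image_subset_range _ _) h1))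

end RegularSequence

theorem totalDegree_pos_of_not_isUnit {σ K : Type*} [Field K] {p : MvPolynomial σ K}
    (h0 : p ≠ 0) (h : ¬ IsUnit p) : 0 < p.totalDegree := by
  refine Nat.pos_of_ne_zero fun hd => h ?_
  have hC := totalDegree_eq_zero_iff_eq_C.1 hd
  rw [hC] at h0 ⊢
  exact (isUnit_iff_ne_zero.2 (ne_of_apply_ne C (by rwa [C_0]))).map C

theorem homogeneousComponent_mul_of_isHomogeneous {σ R : Type*} [CommSemiring R]
    {p q : MvPolynomial σ R} {d : ℕ} (hq : q.IsHomogeneous d) (E : ℕ) :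
    homogeneousComponent E (p * q) =
      if d ≤ E then homogeneousComponent (E - d) p * q else 0 := by
  let _ := gradedAlgebra (σ := σ) (R := R)
  simp only [← decomposition.decompose'_apply]
  exact DirectSum.coe_decompose_mul_of_right_mem (homogeneousSubmodule σ R) E hq

variable {K : Type*} [Field K] {n m : ℕ} {mo : MonomialOrder (Fin n)}
  {f : Fin m → MvPolynomial (Fin n) K} {le : FreeMod K n m → FreeMod K n m → Prop}

/-! ### The map to the polynomial ring -/

theorem proj_zero : proj f (0 : FreeMod K n m) = 0 := by
  simp only [proj, Pi.zero_apply, zero_mul, Finset.sum_const_zero]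

theorem proj_sub (α β : FreeMod K n m) : proj f (α - β) = proj f α - proj f β := by
  simp only [proj, Pi.sub_apply, sub_mul, Finset.sum_sub_distrib]

theorem proj_smul (p : MvPolynomial (Fin n) K) (α : FreeMod K n m) :
    proj f (p • α) = p * proj f α := by
  simp only [proj, Pi.smul_apply, smul_eq_mul, Finset.mul_sum, mul_assoc]

theorem proj_unitVec (i : Fin m) : proj f (unitVec i : FreeMod K n m) = f i := by
  simp [proj, unitVec, Pi.single_apply]

theorem proj_smul_sub_smul (α β : FreeMod K n m) :
    proj f (proj f α • β - proj f β • α) = 0 := by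
  rw [proj_sub, proj_smul, proj_smul, mul_comm, sub_self]

theorem eq_of_coeff_unitVec_ne_zero {i : Fin m} {U : ModMon n m}
    (hU : ((unitVec i : FreeMod K n m) U.1).coeff U.2 ≠ 0) : U = (i, 0) := by
  classical
  have h1 : U.1 = i := by
    by_contra h
    simp [unitVec, h] at hU
  have h2 : U.2 = 0 := by
    by_contra h
    simp [unitVec, h1, coeff_one, Ne.symm h] at hU
  exact Prod.ext h1 h2

/-! ### The order on module monomials -/

/-- The multiple `x^w T` of the module monomial `T`. -/
noncomputable def shift (w : Fin n →₀ ℕ) (T : ModMon n m) : ModMon n m := (T.1, w + T.2)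

theorem shift_add (v w : Fin n →₀ ℕ) (T : ModMon n m) :
    shift (v + w) T = shift v (shift w T) := by
  simp only [shift, add_assoc]

theorem shift_eq_self_iff {w : Fin n →₀ ℕ} {T : ModMon n m} : shift w T = T ↔ w = 0 := by
  simp [shift, Prod.ext_iff]

theorem shift_snd_fst_zero (T : ModMon n m) : shift T.2 (T.1, 0) = T := by
  simp only [shift, add_zero]

theorem modDvd_shift (w : Fin n →₀ ℕ) (T : ModMon n m) : ModDvd T (shift w T) :=
  ⟨rfl, le_add_self⟩

theorem modDvd_iff_exists_shift {S T : ModMon n m} : ModDvd S T ↔ ∃ w, T = shift w S := by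
  constructor
  · rintro ⟨hindex, hle⟩
    exact ⟨T.2 - S.2, Prod.ext hindex.symm (tsub_add_cancel_of_le hle).symm⟩
  · rintro ⟨w, rfl⟩
    exact modDvd_shift w S

theorem ModDvd.trans {S T U : ModMon n m} (h : ModDvd S T) (h' : ModDvd T U) : ModDvd S U :=
  ⟨h.1.trans h'.1, h.2.trans h'.2⟩

theorem sigDegree_eq (hf : ∀ i, f i ≠ 0) (T : ModMon n m) :
    sigDegree f T = T.2.degree + (f T.1).totalDegree := by
  rw [sigDegree, proj_smul, proj_unitVec,
    totalDegree_mul_of_isDomain (monomial_eq_zero.not.2 one_ne_zero) (hf _),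
    totalDegree_monomial _ one_ne_zero]
  rfl

theorem sigDegree_shift (hf : ∀ i, f i ≠ 0) (w : Fin n →₀ ℕ) (T : ModMon n m) :
    sigDegree f (shift w T) = w.degree + sigDegree f T := by
  simp only [sigDegree_eq hf, shift, map_add, add_assoc]

variable (mo f) in
/-- An embedding of the module monomials into a well-order that turns `DPotLT` into `<`. -/
noncomputable def key (T : ModMon n m) : ℕ ×ₗ Fin m ×ₗ mo.syn :=
  toLex (sigDegree f T, toLex (T.1, mo.toSyn T.2))

theorem dPotLT_iff_key_lt {T U : ModMon n m} : DPotLT mo f T U ↔ key mo f T < key mo f U := by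
  simp [DPotLT, PotLT, key, Prod.Lex.toLex_lt_toLex]

theorem key_injective : Function.Injective (key mo f) := by
  rintro ⟨i, a⟩ ⟨j, b⟩ h
  simp only [key, EmbeddingLike.apply_eq_iff_eq, Prod.mk.injEq] at h
  exact Prod.ext h.2.1 h.2.2

theorem key_induction {motive : ModMon n m → Prop} (T : ModMon n m)
    (ih : ∀ T, (∀ U, key mo f U < key mo f T → motive U) → motive T) : motive T :=
  (InvImage.wf (key mo f) wellFounded_lt).induction T ih

theorem sigDegree_le_of_key_le {T U : ModMon n m} (h : key mo f T ≤ key mo f U) :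
    sigDegree f T ≤ sigDegree f U :=
  (Prod.Lex.toLex_le_toLex.1 h).elim le_of_lt fun h => h.1.le

theorem key_lt_of_sigDegree_lt {T U : ModMon n m} (h : sigDegree f T < sigDegree f U) :
    key mo f T < key mo f U :=
  Prod.Lex.toLex_lt_toLex.2 (Or.inl h)

theorem key_le_iff_of_sigDegree_eq {T U : ModMon n m} (h : sigDegree f T = sigDegree f U) :
    key mo f T ≤ key mo f U ↔ T.1 < U.1 ∨ T.1 = U.1 ∧ T.2 ≼[mo] U.2 := by
  simp [key, h, Prod.Lex.toLex_le_toLex]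

theorem key_shift_lt_iff (hf : ∀ i, f i ≠ 0) (w : Fin n →₀ ℕ) {T U : ModMon n m} :
    key mo f (shift w T) < key mo f (shift w U) ↔ key mo f T < key mo f U := by
  simp only [← dPotLT_iff_key_lt, DPotLT, sigDegree_shift hf, add_lt_add_iff_left,
    add_right_inj]
  simp only [PotLT, shift, map_add, add_lt_add_iff_left]

theorem key_shift_le_iff (hf : ∀ i, f i ≠ 0) (w : Fin n →₀ ℕ) {T U : ModMon n m} :
    key mo f (shift w T) ≤ key mo f (shift w U) ↔ key mo f T ≤ key mo f U := by
  rw [← not_lt, key_shift_lt_iff hf, not_lt]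

theorem key_le_key_shift (hf : ∀ i, f i ≠ 0) (w : Fin n →₀ ℕ) (T : ModMon n m) :
    key mo f T ≤ key mo f (shift w T) := by
  have hdeg : sigDegree f T ≤ sigDegree f (shift w T) := by
    rw [sigDegree_shift hf]
    exact le_add_self
  rcases hdeg.lt_or_eq with hlt | heq
  · exact (key_lt_of_sigDegree_lt hlt).le
  · refine (key_le_iff_of_sigDegree_eq heq).2 (Or.inr ⟨rfl, ?_⟩)
    rw [shift, map_add]
    exact le_add_of_nonneg_left (mo.zero_le _)

/-! ### Signatures -/

theorem hasSig_iff {α : FreeMod K n m} {T : ModMon n m} :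
    HasSig mo f α T ↔ (α T.1).coeff T.2 ≠ 0 ∧
      ∀ U : ModMon n m, (α U.1).coeff U.2 ≠ 0 → key mo f U ≤ key mo f T := by
  refine and_congr_right fun _ => forall₂_congr fun U _ => ?_
  rw [dPotLT_iff_key_lt, le_iff_eq_or_lt, key_injective.eq_iff, or_iff_not_imp_left]

theorem HasSig.key_le {α : FreeMod K n m} {T U : ModMon n m} (h : HasSig mo f α T)
    (hU : (α U.1).coeff U.2 ≠ 0) : key mo f U ≤ key mo f T :=
  (hasSig_iff.1 h).2 U hU

theorem HasSig.unique {α : FreeMod K n m} {S T : ModMon n m} (hS : HasSig mo f α S)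
    (hT : HasSig mo f α T) : S = T :=
  key_injective (le_antisymm (hT.key_le hS.1) (hS.key_le hT.1))

theorem HasSig.apply_ne_zero {α : FreeMod K n m} {T : ModMon n m} (h : HasSig mo f α T) :
    α T.1 ≠ 0 :=
  ne_zero_iff.2 ⟨_, h.1⟩

theorem HasSig.ne_zero {α : FreeMod K n m} {T : ModMon n m} (h : HasSig mo f α T) : α ≠ 0 :=
  Function.ne_iff.2 ⟨_, h.apply_ne_zero⟩

variable (mo f) in
theorem exists_hasSig {α : FreeMod K n m} (h : α ≠ 0) : ∃ T, HasSig mo f α T := by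
  classical
  let terms : Finset (ModMon n m) :=
    Finset.univ.biUnion fun i => (α i).support.map ⟨Prod.mk i, Prod.mk_right_injective i⟩
  have hterms : ∀ U : ModMon n m, U ∈ terms ↔ (α U.1).coeff U.2 ≠ 0 := by
    rintro ⟨i, a⟩
    simp [terms]
  obtain ⟨i, hi⟩ := Function.ne_iff.1 h
  obtain ⟨a, ha⟩ := ne_zero_iff.1 hi
  obtain ⟨T, hT, hmax⟩ := terms.exists_max_image (key mo f) ⟨(i, a), (hterms _).2 ha⟩
  exact ⟨T, hasSig_iff.2 ⟨(hterms T).1 hT, fun U hU => hmax U ((hterms U).2 hU)⟩⟩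

theorem exists_hasSig_of_proj_ne_zero {α : FreeMod K n m} (h : proj f α ≠ 0) :
    ∃ T, HasSig mo f α T :=
  exists_hasSig mo f (by rintro rfl; exact h proj_zero)

theorem hasSig_unitVec (i : Fin m) : HasSig mo f (unitVec i : FreeMod K n m) (i, 0) :=
  hasSig_iff.2 ⟨by simp [unitVec], fun _ hU => (congrArg _ (eq_of_coeff_unitVec_ne_zero hU)).le⟩

theorem HasSig.neg {α : FreeMod K n m} {T : ModMon n m} (h : HasSig mo f α T) :
    HasSig mo f (-α) T := by
  simpa [HasSig] using h

theorem coeff_ne_zero_or_of_coeff_sub_ne_zero {α β : FreeMod K n m} {U : ModMon n m}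
    (h : ((α - β) U.1).coeff U.2 ≠ 0) : (α U.1).coeff U.2 ≠ 0 ∨ (β U.1).coeff U.2 ≠ 0 := by
  contrapose! h
  rw [Pi.sub_apply, coeff_sub, h.1, h.2, sub_zero]

theorem HasSig.sub_of_lt {α β : FreeMod K n m} {S T : ModMon n m} (hα : HasSig mo f α T)
    (hβ : HasSig mo f β S) (h : key mo f S < key mo f T) : HasSig mo f (α - β) T := by
  have h0 : (β T.1).coeff T.2 = 0 := by
    by_contra h0
    exact (hβ.key_le h0).not_gt h
  refine hasSig_iff.2 ⟨by simpa [h0] using hα.1, fun U hU => ?_⟩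
  rcases coeff_ne_zero_or_of_coeff_sub_ne_zero hU with hU | hU
  · exact hα.key_le hU
  · exact (hβ.key_le hU).trans h.le

theorem coeff_monomial_smul_shift (w : Fin n →₀ ℕ) (c : K) (α : FreeMod K n m)
    (T : ModMon n m) :
    ((monomial w c • α) (shift w T).1).coeff (shift w T).2 = c * (α T.1).coeff T.2 := by
  simp [shift]

theorem exists_eq_shift_of_coeff_ne_zero {w : Fin n →₀ ℕ} {c : K} {α : FreeMod K n m}
    {U : ModMon n m} (h : ((monomial w c • α) U.1).coeff U.2 ≠ 0) :
    ∃ V : ModMon n m, U = shift w V ∧ (α V.1).coeff V.2 ≠ 0 := by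
  simp only [Pi.smul_apply, smul_eq_mul, coeff_monomial_mul', ite_ne_right_iff] at h
  exact ⟨(U.1, U.2 - w), Prod.ext rfl (add_tsub_cancel_of_le h.1).symm, right_ne_zero_of_mul h.2⟩

theorem HasSig.monomial_smul (hf : ∀ i, f i ≠ 0) {α : FreeMod K n m} {T : ModMon n m}
    (h : HasSig mo f α T) (w : Fin n →₀ ℕ) {c : K} (hc : c ≠ 0) :
    HasSig mo f (monomial w c • α) (shift w T) := by
  refine hasSig_iff.2 ⟨?_, fun U hU => ?_⟩
  · rw [coeff_monomial_smul_shift]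
    exact mul_ne_zero hc h.1
  · obtain ⟨V, rfl, hV⟩ := exists_eq_shift_of_coeff_ne_zero hU
    exact (key_shift_le_iff hf w).2 (h.key_le hV)

theorem HasSig.exists_of_monomial_smul (hf : ∀ i, f i ≠ 0) {α : FreeMod K n m}
    {T : ModMon n m} {w : Fin n →₀ ℕ} {c : K} (h : HasSig mo f (monomial w c • α) T) :
    ∃ S, HasSig mo f α S ∧ T = shift w S := by
  have hc : c ≠ 0 := by
    rintro rfl
    exact h.ne_zero (by rw [monomial_zero, zero_smul])
  obtain ⟨S, hS⟩ := exists_hasSig mo f (right_ne_zero_of_smul h.ne_zero)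
  exact ⟨S, hS, h.unique (hS.monomial_smul hf w hc)⟩

theorem HasSig.exists_cancel (hf : ∀ i, f i ≠ 0) {α β : FreeMod K n m} {S : ModMon n m}
    {w : Fin n →₀ ℕ} (hα : HasSig mo f α (shift w S)) (hβ : HasSig mo f β S) :
    ∃ c : K, c ≠ 0 ∧ ∀ U, HasSig mo f (α - monomial w c • β) U →
      key mo f U < key mo f (shift w S) := by
  set c : K := (α (shift w S).1).coeff (shift w S).2 / (β S.1).coeff S.2 with hc
  have hc0 : c ≠ 0 := div_ne_zero hα.1 hβ.1
  have hcancel : ((α - monomial w c • β) (shift w S).1).coeff (shift w S).2 = 0 := by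
    rw [Pi.sub_apply, coeff_sub, coeff_monomial_smul_shift, hc, div_mul_cancel₀ _ hβ.1, sub_self]
  refine ⟨c, hc0, fun U hU => lt_of_le_of_ne ?_ fun he => hU.1 ?_⟩
  · rcases coeff_ne_zero_or_of_coeff_sub_ne_zero hU.1 with h | h
    · exact hα.key_le h
    · exact (hβ.monomial_smul hf w hc0).key_le h
  · rwa [key_injective he]

/-! ### Homogeneous elements of the free module -/

/-- `α` is homogeneous of degree `D` for the grading in which `e_i` has the degree of `f_i`: all
module monomials that occur in `α` have degree `D`. The zero element has every degree. -/
def IsHom (f : Fin m → MvPolynomial (Fin n) K) (α : FreeMod K n m) (D : ℕ) : Prop :=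
  ∀ U : ModMon n m, (α U.1).coeff U.2 ≠ 0 → sigDegree f U = D

theorem isHom_unitVec (i : Fin m) :
    IsHom f (unitVec i : FreeMod K n m) (sigDegree f (i, (0 : Fin n →₀ ℕ))) :=
  fun _ hU => by rw [eq_of_coeff_unitVec_ne_zero hU]

theorem IsHom.sub {α β : FreeMod K n m} {D : ℕ} (hα : IsHom f α D) (hβ : IsHom f β D) :
    IsHom f (α - β) D := fun U hU =>
  (coeff_ne_zero_or_of_coeff_sub_ne_zero hU).elim (hα U) (hβ U)

theorem degree_eq_of_isHomogeneous {σ R : Type*} [CommSemiring R] {p : MvPolynomial σ R} {d : ℕ}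
    (hp : p.IsHomogeneous d) {a : σ →₀ ℕ} (ha : p.coeff a ≠ 0) : a.degree = d :=
  of_not_not fun h => ha (hp.coeff_eq_zero h)

theorem IsHom.smul (hf : ∀ i, f i ≠ 0) {p : MvPolynomial (Fin n) K} {α : FreeMod K n m}
    {d D : ℕ} (hp : p.IsHomogeneous d) (hα : IsHom f α D) : IsHom f (p • α) (d + D) := by
  intro U hU
  obtain ⟨⟨a, b⟩, hab, hne⟩ := Finset.exists_ne_zero_of_sum_ne_zero
    (coeff_mul p (α U.1) U.2 ▸ hU)
  have hU : U = shift a (U.1, b) :=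
    Prod.ext rfl (Finset.HasAntidiagonal.mem_antidiagonal.1 hab).symm
  rw [hU, sigDegree_shift hf, hα _ (right_ne_zero_of_mul hne),
    degree_eq_of_isHomogeneous hp (left_ne_zero_of_mul hne)]

theorem IsHom.monomial_smul (hf : ∀ i, f i ≠ 0) {α : FreeMod K n m} {D : ℕ} (h : IsHom f α D)
    (w : Fin n →₀ ℕ) (c : K) : IsHom f (monomial w c • α) (w.degree + D) :=
  h.smul hf (isHomogeneous_monomial c rfl)

theorem IsHom.isHomogeneous_apply (hf : ∀ i, f i ≠ 0) {α : FreeMod K n m} {D : ℕ}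
    (h : IsHom f α D) (i : Fin m) : (α i).IsHomogeneous (D - (f i).totalDegree) := by
  intro a ha
  rw [← h (i, a) ha, sigDegree_eq hf, add_tsub_cancel_right]
  exact (DFunLike.congr_fun (Finsupp.degree_eq_weight_one (R := ℕ)) a).symm

theorem IsHom.isHomogeneous_proj (hf : ∀ i, f i ≠ 0)
    (hhom : ∀ i, (f i).IsHomogeneous (f i).totalDegree)
    {α : FreeMod K n m} {D : ℕ} (h : IsHom f α D) : (proj f α).IsHomogeneous D := by
  refine IsHomogeneous.sum _ _ _ fun i _ => ?_
  rcases eq_or_ne (α i) 0 with h0 | h0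
  · rw [h0, zero_mul]
    exact isHomogeneous_zero _ _ _
  · obtain ⟨a, ha⟩ := ne_zero_iff.1 h0
    have hle : (f i).totalDegree ≤ D := by
      rw [← h (i, a) ha, sigDegree_eq hf]
      exact le_add_self
    simpa only [tsub_add_cancel_of_le hle] using (h.isHomogeneous_apply hf i).mul (hhom i)

theorem IsHom.degree_eq_of_mem_support (hf : ∀ i, f i ≠ 0)
    (hhom : ∀ i, (f i).IsHomogeneous (f i).totalDegree) {α : FreeMod K n m} {D : ℕ}
    (h : IsHom f α D) {v : Fin n →₀ ℕ} (hv : v ∈ (proj f α).support) : v.degree = D :=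
  degree_eq_of_isHomogeneous (h.isHomogeneous_proj hf hhom) (mem_support_iff.1 hv)

theorem IsHom.hasSig {α : FreeMod K n m} {D : ℕ} (h : IsHom f α D) {k : Fin m}
    (hk : α k ≠ 0) (hmax : ∀ j, α j ≠ 0 → j ≤ k) :
    HasSig mo f α (k, mo.degree (α k)) := by
  have hlead : (α k).coeff (mo.degree (α k)) ≠ 0 := mem_support_iff.1 (mo.degree_mem_support hk)
  refine hasSig_iff.2 ⟨hlead, fun ⟨j, a⟩ hU => ?_⟩
  refine (key_le_iff_of_sigDegree_eq ((h _ hU).trans (h (k, _) hlead).symm)).2 ?_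
  rcases (hmax j (ne_zero_iff.2 ⟨a, hU⟩)).lt_or_eq with hlt | rfl
  · exact Or.inl hlt
  · exact Or.inr ⟨rfl, mo.le_degree (mem_support_iff.2 hU)⟩

theorem IsHom.index_le {α : FreeMod K n m} {D : ℕ} (h : IsHom f α D) {T : ModMon n m}
    (hT : HasSig mo f α T) {j : Fin m} (hj : α j ≠ 0) : j ≤ T.1 := by
  obtain ⟨a, ha⟩ := ne_zero_iff.1 hj
  rcases (key_le_iff_of_sigDegree_eq ((h (j, a) ha).trans (h T hT.1).symm)).1
    (hT.key_le (U := (j, a)) ha) with hlt | ⟨heq, -⟩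
  · exact hlt.le
  · exact heq.le

theorem IsHom.degree_apply_eq {α : FreeMod K n m} {D : ℕ} (h : IsHom f α D) {T : ModMon n m}
    (hT : HasSig mo f α T) : mo.degree (α T.1) = T.2 :=
  congrArg Prod.snd ((h.hasSig hT.apply_ne_zero fun _ => h.index_le hT).unique hT)

theorem hasSig_koszul (hf : ∀ i, f i ≠ 0) (hhom : ∀ i, (f i).IsHomogeneous (f i).totalDegree)
    {α : FreeMod K n m} {D : ℕ} (hα : IsHom f α D) {S : ModMon n m} (hS : HasSig mo f α S)
    (h0 : proj f α ≠ 0) {k : Fin m} (hk : S.1 < k) :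
    HasSig mo f (proj f α • unitVec k - f k • α) (k, mo.degree (proj f α)) := by
  have happly : ∀ j, k ≤ j → (proj f α • unitVec k - f k • α : FreeMod K n m) j =
      proj f α * unitVec (K := K) k j := fun j hj => by
    have hαj : α j = 0 := by
      by_contra hne
      exact (hj.trans (hα.index_le hS hne)).not_gt hk
    simp only [Pi.sub_apply, Pi.smul_apply, smul_eq_mul, hαj, mul_zero, sub_zero]
  have hhomogeneous : IsHom f (proj f α • unitVec k - f k • α) (D + (f k).totalDegree) := by
    refine IsHom.sub ?_ (add_comm D _ ▸ hα.smul hf (hhom k))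
    simpa [sigDegree_eq hf] using (isHom_unitVec k).smul hf (hα.isHomogeneous_proj hf hhom)
  have hcomp : (proj f α • unitVec k - f k • α : FreeMod K n m) k = proj f α := by
    rw [happly k le_rfl, unitVec, Pi.single_eq_same, mul_one]
  have hsig := hhomogeneous.hasSig (mo := mo) (by rwa [hcomp]) fun j hj => by
    by_contra! hlt
    exact hj (by rw [happly j hlt.le, unitVec, Pi.single_eq_of_ne hlt.ne', mul_zero])
  rwa [hcomp] at hsig


/-! ### Lead terms and S-pairs -/

theorem degree_proj_monomial_smul {α : FreeMod K n m} (h : proj f α ≠ 0) (w : Fin n →₀ ℕ)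
    {c : K} (hc : c ≠ 0) :
    mo.degree (proj f (monomial w c • α)) = w + mo.degree (proj f α) := by
  classical
  rw [proj_smul, mo.degree_mul (by simpa using hc) h, mo.degree_monomial, if_neg hc]

/-- The exponent of the monomial `cofactor mo f α β`. -/
noncomputable def cofactorExp (mo : MonomialOrder (Fin n)) (f : Fin m → MvPolynomial (Fin n) K)
    (α β : FreeMod K n m) : Fin n →₀ ℕ :=
  (mo.degree (proj f α) ⊔ mo.degree (proj f β)) - mo.degree (proj f α)

theorem cofactorExp_add_degree (α β : FreeMod K n m) :
    cofactorExp mo f α β + mo.degree (proj f α) =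
      mo.degree (proj f α) ⊔ mo.degree (proj f β) :=
  tsub_add_cancel_of_le le_sup_left

theorem exists_eq_add_cofactorExp {α β : FreeMod K n m} {a b : Fin n →₀ ℕ}
    (h : a + mo.degree (proj f α) = b + mo.degree (proj f β)) :
    ∃ r, a = r + cofactorExp mo f α β ∧ b = r + cofactorExp mo f β α := by
  obtain ⟨r, hr⟩ := exists_add_of_le (sup_le le_add_self (h ▸ le_add_self) :
    mo.degree (proj f α) ⊔ mo.degree (proj f β) ≤ a + mo.degree (proj f α))
  refine ⟨r, add_right_cancel (b := mo.degree (proj f α)) ?_,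
    add_right_cancel (b := mo.degree (proj f β)) ?_⟩
  · rw [add_assoc, cofactorExp_add_degree, hr, add_comm]
  · rw [← h, add_assoc, cofactorExp_add_degree, hr, add_comm, sup_comm]

theorem HasSig.cofactor_smul (hf : ∀ i, f i ≠ 0) {α : FreeMod K n m} (β : FreeMod K n m)
    (h0 : proj f α ≠ 0) {S : ModMon n m} (h : HasSig mo f α S) :
    HasSig mo f (cofactor mo f α β • α) (shift (cofactorExp mo f α β) S) :=
  h.monomial_smul hf _ (inv_ne_zero (mo.leadingCoeff_ne_zero_iff.2 h0))

theorem HasSig.exists_of_cofactor_smul (hf : ∀ i, f i ≠ 0) {α β : FreeMod K n m}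
    {T : ModMon n m} (h : HasSig mo f (cofactor mo f α β • α) T) :
    ∃ S, HasSig mo f α S ∧ T = shift (cofactorExp mo f α β) S :=
  h.exists_of_monomial_smul hf

theorem degree_proj_cofactor_smul {α : FreeMod K n m} (β : FreeMod K n m) (h0 : proj f α ≠ 0) :
    mo.degree (proj f (cofactor mo f α β • α)) =
      mo.degree (proj f α) ⊔ mo.degree (proj f β) := by
  rw [cofactor, degree_proj_monomial_smul h0 _ (inv_ne_zero (mo.leadingCoeff_ne_zero_iff.2 h0))]
  exact cofactorExp_add_degree α β

theorem leadingCoeff_proj_cofactor_smul {α : FreeMod K n m} (β : FreeMod K n m)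
    (h0 : proj f α ≠ 0) : mo.leadingCoeff (proj f (cofactor mo f α β • α)) = 1 := by
  rw [cofactor, proj_smul, mo.leadingCoeff_mul, mo.leadingCoeff_monomial,
    inv_mul_cancel₀ (mo.leadingCoeff_ne_zero_iff.2 h0)]

/-- All monomials of `p` are smaller than `x^u`. -/
def IsBelow {σ R : Type*} [CommSemiring R] (mo : MonomialOrder σ) (p : MvPolynomial σ R)
    (u : σ →₀ ℕ) : Prop :=
  ∀ v ∈ p.support, v ≺[mo] u

theorem IsBelow.sub {σ R : Type*} [CommRing R] {mo : MonomialOrder σ} {p q : MvPolynomial σ R}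
    {u : σ →₀ ℕ} (hp : IsBelow mo p u) (hq : IsBelow mo q u) : IsBelow mo (p - q) u := by
  classical
  exact fun v hv => (Finset.mem_union.1 (support_sub _ p q hv)).elim (hp v) (hq v)

theorem isBelow_sub_of_degree_eq_of_leadingCoeff_eq {σ R : Type*} [CommRing R]
    {mo : MonomialOrder σ} {p q : MvPolynomial σ R} (hdeg : mo.degree p = mo.degree q)
    (hcoeff : mo.leadingCoeff p = mo.leadingCoeff q) :
    IsBelow mo (p - q) (mo.degree p) := by
  classical
  intro v hv
  refine lt_of_le_of_ne ?_ fun he => mem_support_iff.1 hv ?_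
  · rcases Finset.mem_union.1 (support_sub _ _ _ hv) with h | h
    · exact mo.le_degree h
    · exact hdeg ▸ mo.le_degree h
  · obtain rfl := mo.toSyn.injective he
    rw [coeff_sub, sub_eq_zero]
    exact hcoeff.trans (by rw [hdeg, MonomialOrder.leadingCoeff])

theorem isBelow_spair {α β : FreeMod K n m} (hα : proj f α ≠ 0) (hβ : proj f β ≠ 0) :
    IsBelow mo (proj f ((Pair.spair α β).value mo f))
      (mo.degree (proj f α) ⊔ mo.degree (proj f β)) := by
  rw [Pair.value, proj_sub, ← degree_proj_cofactor_smul β hα]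
  refine isBelow_sub_of_degree_eq_of_leadingCoeff_eq ?_ ?_
  · rw [degree_proj_cofactor_smul β hα, degree_proj_cofactor_smul α hβ, sup_comm]
  · rw [leadingCoeff_proj_cofactor_smul β hα, leadingCoeff_proj_cofactor_smul α hβ]

theorem IsHom.cofactor_smul (hf : ∀ i, f i ≠ 0)
    (hhom : ∀ i, (f i).IsHomogeneous (f i).totalDegree) {α : FreeMod K n m} (β : FreeMod K n m)
    {D : ℕ} (h : IsHom f α D) (h0 : proj f α ≠ 0) :
    IsHom f (cofactor mo f α β • α)
      (mo.degree (proj f α) ⊔ mo.degree (proj f β)).degree := by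
  rw [← cofactorExp_add_degree, map_add,
    h.degree_eq_of_mem_support hf hhom (mo.degree_mem_support h0)]
  exact h.smul hf (isHomogeneous_monomial _ rfl)

theorem exists_isHom_spair (hf : ∀ i, f i ≠ 0)
    (hhom : ∀ i, (f i).IsHomogeneous (f i).totalDegree) {α β : FreeMod K n m}
    (hα0 : proj f α ≠ 0) (hβ0 : proj f β ≠ 0) (hα : ∃ D, IsHom f α D) (hβ : ∃ D, IsHom f β D) :
    ∃ D, IsHom f ((Pair.spair α β).value mo f) D := by
  obtain ⟨D, hD⟩ := hα
  obtain ⟨E, hE⟩ := hβ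
  refine ⟨_, (hD.cofactor_smul hf hhom β hα0).sub ?_⟩
  rw [sup_comm]
  exact hE.cofactor_smul hf hhom α hβ0

theorem IsRegularPair.hasSig_generator {α β : FreeMod K n m} (h : IsRegularPair mo f α β)
    {T : ModMon n m} (hT : HasSig mo f ((Pair.spair α β).value mo f) T) :
    (HasSig mo f (cofactor mo f α β • α) T ∧
      ∃ U, HasSig mo f (cofactor mo f β α • β) U ∧ key mo f U < key mo f T) ∨
    (HasSig mo f (cofactor mo f β α • β) T ∧
      ∃ U, HasSig mo f (cofactor mo f α β • α) U ∧ key mo f U < key mo f T) := by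
  obtain ⟨S, U, hS, hU, hne⟩ := h
  rcases (key_injective.ne hne : key mo f S ≠ key mo f U).lt_or_gt with hlt | hlt
  · obtain rfl := hT.unique (neg_sub (_ : FreeMod K n m) _ ▸ (hU.sub_of_lt hS hlt).neg)
    exact Or.inr ⟨hU, S, hS, hlt⟩
  · obtain rfl := hT.unique (hS.sub_of_lt hU hlt)
    exact Or.inl ⟨hS, U, hU, hlt⟩

/-! ### Rewriters and reducers -/

variable {G H G' H' : Set (FreeMod K n m)}

theorem Rewritable.of_modDvd {α : FreeMod K n m} {S T : ModMon n m}
    (h : Rewritable mo f le G H α S) (hST : ModDvd S T) : Rewritable mo f le G H α T := by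
  obtain ⟨γ, hγ, hne, hle, U, hU, hUS⟩ := h
  exact ⟨γ, hγ, hne, hle, U, hU, hUS.trans hST⟩

theorem Rewritable.mono {α : FreeMod K n m} {S : ModMon n m} (h : Rewritable mo f le G H α S)
    (hG : G ⊆ G') (hH : H ⊆ H') : Rewritable mo f le G' H' α S := by
  obtain ⟨γ, hγ, hrewriter⟩ := h
  exact ⟨γ, Set.union_subset_union hG hH hγ, hrewriter⟩

theorem IsRewriteOrder.exists_max (h : IsRewriteOrder le G H) {A : Set (FreeMod K n m)}
    (hA : A.Finite) (hAG : A ⊆ G) (hne : A.Nonempty) : ∃ γ ∈ A, ∀ α ∈ A, le α γ := by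
  induction A, hA using Set.Finite.induction_on with
  | empty => exact absurd hne Set.not_nonempty_empty
  | @insert a A _ _ ih =>
    have ha : a ∈ G := hAG (Set.mem_insert _ _)
    have hA : A ⊆ G := (Set.subset_insert _ _).trans hAG
    rcases A.eq_empty_or_nonempty with rfl | hne'
    · exact ⟨a, by simp, by simpa using h.refl a (Or.inl ha)⟩
    · obtain ⟨γ, hγ, hmax⟩ := ih hA hne'
      rcases h.total a ha γ (hA hγ) with hle | hle
      · exact ⟨γ, Or.inr hγ, Set.forall_mem_insert.2 ⟨hle, hmax⟩⟩
      · exact ⟨a, Or.inl rfl, Set.forall_mem_insert.2 ⟨h.refl _ (Or.inl ha), fun α hα =>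
          h.trans _ (Or.inl (hA hα)) _ (Or.inl (hA hγ)) _ (Or.inl ha) (hmax α hα) hle⟩⟩

theorem IsRewriteOrder.exists_not_rewritable (hle : IsRewriteOrder le G H) (hfin : G.Finite)
    {T : ModMon n m} (hT : ∃ γ ∈ G ∪ H, IsRewriter mo f γ T)
    (hH : ∀ σ ∈ H, ¬ IsRewriter mo f σ T) :
    ∃ γ ∈ G, IsRewriter mo f γ T ∧ ¬ Rewritable mo f le G H γ T := by
  have hne : {γ ∈ G | IsRewriter mo f γ T}.Nonempty := by
    obtain ⟨γ, hγ | hγ, hγT⟩ := hT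
    · exact ⟨γ, hγ, hγT⟩
    · exact absurd hγT (hH γ hγ)
  obtain ⟨γ, ⟨hγ, hγT⟩, hmax⟩ :=
    hle.exists_max (hfin.subset (Set.sep_subset _ _)) (Set.sep_subset _ _) hne
  refine ⟨γ, hγ, hγT, ?_⟩
  rintro ⟨δ, hδ | hδ, hne, hγδ, hδT⟩
  · exact hne (hle.antisymm _ (Or.inl hδ) _ (Or.inl hγ) (hmax δ ⟨hδ, hδT⟩) hγδ)
  · exact hH δ hδ hδT

/-- The set `G` can reduce the monomial `x^u` in signature `V`: a monomial multiple of an element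
of `G` has the lead monomial `x^u` and the signature `V`. -/
def IsMultiple (mo : MonomialOrder (Fin n)) (f : Fin m → MvPolynomial (Fin n) K)
    (G : Set (FreeMod K n m)) (u : Fin n →₀ ℕ) (V : ModMon n m) : Prop :=
  ∃ β ∈ G, ∃ S w, HasSig mo f β S ∧ w + mo.degree (proj f β) = u ∧ V = shift w S

/-- The monomial `x^u` in the image of an element of signature `T` is regular s-reducible. -/
def IsRegularReducible (mo : MonomialOrder (Fin n)) (f : Fin m → MvPolynomial (Fin n) K)
    (G : Set (FreeMod K n m)) (T : ModMon n m) (u : Fin n →₀ ℕ) : Prop :=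
  ∃ V, key mo f V < key mo f T ∧ IsMultiple mo f G u V

/-- All elements of signature `T` with nonzero image are s-reducible at the lead term. -/
def ReducibleAt (mo : MonomialOrder (Fin n)) (f : Fin m → MvPolynomial (Fin n) K)
    (G : Set (FreeMod K n m)) (T : ModMon n m) : Prop :=
  ∀ α, HasSig mo f α T → proj f α ≠ 0 →
    ∃ V, key mo f V ≤ key mo f T ∧ IsMultiple mo f G (mo.degree (proj f α)) V

theorem HasSig.exists_isRegularReducible_sub (hf : ∀ i, f i ≠ 0) {α β : FreeMod K n m}
    {S : ModMon n m} {w : Fin n →₀ ℕ}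
    (hG : ∀ U, key mo f U < key mo f (shift w S) → ReducibleAt mo f G U)
    (hα : HasSig mo f α (shift w S)) (hβ : HasSig mo f β S) :
    ∃ c : K, c ≠ 0 ∧ (proj f (α - monomial w c • β) ≠ 0 →
      IsRegularReducible mo f G (shift w S) (mo.degree (proj f (α - monomial w c • β)))) := by
  obtain ⟨c, hc, hlt⟩ := hα.exists_cancel hf hβ
  refine ⟨c, hc, fun h0 => ?_⟩
  obtain ⟨U, hU⟩ := exists_hasSig_of_proj_ne_zero (mo := mo) h0
  obtain ⟨V, hV, hmul⟩ := hG U (hlt U hU) _ hU h0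
  exact ⟨V, hV.trans_lt (hlt U hU), hmul⟩

theorem HasSig.degree_eq_or_isRegularReducible (hf : ∀ i, f i ≠ 0) {α β : FreeMod K n m}
    {S : ModMon n m} {w : Fin n →₀ ℕ}
    (hG : ∀ U, key mo f U < key mo f (shift w S) → ReducibleAt mo f G U)
    (hα : HasSig mo f α (shift w S)) (hβ : HasSig mo f β S) (hβ0 : proj f β ≠ 0) :
    w + mo.degree (proj f β) = mo.degree (proj f α) ∨
      IsRegularReducible mo f G (shift w S) (mo.degree (proj f α)) ∨
      IsRegularReducible mo f G (shift w S) (w + mo.degree (proj f β)) := by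
  obtain ⟨c, hc, h⟩ := hα.exists_isRegularReducible_sub hf hG hβ
  rw [← degree_proj_monomial_smul hβ0 w hc]
  rw [proj_sub] at h
  rcases lt_trichotomy (mo.toSyn (mo.degree (proj f (monomial w c • β))))
    (mo.toSyn (mo.degree (proj f α))) with hlt | heq | hgt
  · rw [mo.degree_sub_of_lt hlt] at h
    exact Or.inr (Or.inl (h (sub_ne_zero.2 fun he => hlt.ne (by rw [he]))))
  · exact Or.inl (mo.toSyn.injective heq)
  · rw [← mo.degree_neg, neg_sub, mo.degree_sub_of_lt hgt] at h
    exact Or.inr (Or.inr (h (sub_ne_zero.2 fun he => hgt.ne (by rw [he]))))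

theorem HasSig.isRegularReducible_of_syzygy (hf : ∀ i, f i ≠ 0) {α σ : FreeMod K n m}
    {T : ModMon n m} (hG : ∀ U, key mo f U < key mo f T → ReducibleAt mo f G U)
    (hα : HasSig mo f α T) (hα0 : proj f α ≠ 0) (hσ : IsRewriter mo f σ T)
    (hσ0 : proj f σ = 0) : IsRegularReducible mo f G T (mo.degree (proj f α)) := by
  obtain ⟨S, hS, hST⟩ := hσ
  obtain ⟨w, rfl⟩ := modDvd_iff_exists_shift.1 hST
  obtain ⟨c, -, h⟩ := hα.exists_isRegularReducible_sub hf hG hS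
  have hproj : proj f (α - monomial w c • σ) = proj f α := by
    rw [proj_sub, proj_smul, hσ0, mul_zero, sub_zero]
  rw [hproj] at h
  exact h hα0

theorem ne_shift_cofactorExp_of_not_isRegularReducible {β γ : FreeMod K n m} {S T : ModMon n m}
    (hirr : ¬ IsRegularReducible mo f G T (mo.degree (proj f γ))) (hβ : β ∈ G)
    (hS : HasSig mo f β S) (hlt : key mo f (shift (cofactorExp mo f β γ) S) <
      key mo f (shift (cofactorExp mo f γ β) T)) :
    T ≠ shift (cofactorExp mo f γ β) T := by
  intro h
  refine hirr ⟨_, hlt.trans_eq (congrArg _ h.symm), β, hβ, S, _, hS, ?_, rfl⟩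
  rw [cofactorExp_add_degree, sup_comm, ← cofactorExp_add_degree, shift_eq_self_iff.1 h.symm,
    zero_add]

/-! ### The pair set -/

/-- The S-pair of the same two elements in the other order. It has the same value up to sign, and
RB treats only one of the two. -/
def Pair.swap : Pair K n m → Pair K n m
  | .unit i => .unit i
  | .spair α β => .spair β α

/-- The pairs that RB has to treat before its computation with the basis `G` is complete: the unit
vectors and the regular S-pairs of elements of `G`. -/
def Pair.IsCandidate (mo : MonomialOrder (Fin n)) (f : Fin m → MvPolynomial (Fin n) K)
    (G : Set (FreeMod K n m)) : Pair K n m → Prop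
  | .unit _ => True
  | .spair α β => α ∈ G ∧ β ∈ G ∧ IsRegularPair mo f α β

/-- The monomials of `g` are smaller than the least common multiple from which the S-pair is
formed. Nothing is required for a unit vector. -/
def Pair.IsBelowLcm (mo : MonomialOrder (Fin n)) (f : Fin m → MvPolynomial (Fin n) K) :
    Pair K n m → MvPolynomial (Fin n) K → Prop
  | .unit _, _ => True
  | .spair α β, g => IsBelow mo g (mo.degree (proj f α) ⊔ mo.degree (proj f β))

/-- RB has nothing left to do for the pair: it is rewritable, or `G ∪ H` contains what may have
resulted from its reduction. -/
def Pair.IsSettled (mo : MonomialOrder (Fin n)) (f : Fin m → MvPolynomial (Fin n) K)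
    (le : FreeMod K n m → FreeMod K n m → Prop) (G H : Set (FreeMod K n m))
    (p : Pair K n m) : Prop :=
  p.IsRewritable mo f le G H ∨
    ∃ γ ∈ G ∪ H, ∃ T, HasSig mo f (p.value mo f) T ∧ HasSig mo f γ T ∧
      p.IsBelowLcm mo f (proj f γ)

/-- The pair is settled or, possibly after an exchange of its two elements, in the pair set. -/
def Pair.IsCovered (mo : MonomialOrder (Fin n)) (f : Fin m → MvPolynomial (Fin n) K)
    (le : FreeMod K n m → FreeMod K n m → Prop) (s : State K n m) (p : Pair K n m) : Prop :=
  p ∈ s.P ∨ p.swap ∈ s.P ∨ p.IsSettled mo f le s.G s.H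

theorem Pair.swap_swap (p : Pair K n m) : p.swap.swap = p := by
  cases p <;> rfl

theorem Pair.hasSig_value_swap {p : Pair K n m} {T : ModMon n m}
    (h : HasSig mo f (p.value mo f) T) : HasSig mo f (p.swap.value mo f) T := by
  cases p with
  | unit i => exact h
  | spair α β =>
    have hneg := h.neg
    rwa [Pair.value, neg_sub] at hneg

theorem Pair.IsRewritable.mono {p : Pair K n m} (h : p.IsRewritable mo f le G H) (hG : G ⊆ G')
    (hH : H ⊆ H') : p.IsRewritable mo f le G' H' := by
  cases p with
  | unit i =>
    obtain ⟨γ, hγ, hrewriter⟩ := h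
    exact ⟨γ, Set.union_subset_union hG hH hγ, hrewriter⟩
  | spair α β =>
    exact h.imp (fun ⟨S, hS, hα⟩ => ⟨S, hS, hα.mono hG hH⟩)
      fun ⟨S, hS, hβ⟩ => ⟨S, hS, hβ.mono hG hH⟩

theorem Pair.IsSettled.mono {p : Pair K n m} (h : p.IsSettled mo f le G H) (hG : G ⊆ G')
    (hH : H ⊆ H') : p.IsSettled mo f le G' H' :=
  h.imp (·.mono hG hH) fun ⟨γ, hγ, hresult⟩ => ⟨γ, Set.union_subset_union hG hH hγ, hresult⟩

theorem Pair.IsSettled.swap {p : Pair K n m} (h : p.IsSettled mo f le G H) :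
    p.swap.IsSettled mo f le G H := by
  cases p with
  | unit i => exact h
  | spair α β =>
    refine h.imp Or.symm ?_
    rintro ⟨γ, hγ, T, hT, hγT, hbelow⟩
    refine ⟨γ, hγ, T, Pair.hasSig_value_swap hT, hγT, ?_⟩
    change IsBelow mo _ (mo.degree (proj f β) ⊔ mo.degree (proj f α))
    rwa [sup_comm]

theorem Pair.IsSettled.exists_isRewriter_of_unit {k : Fin m}
    (h : (Pair.unit k).IsSettled mo f le G H) : ∃ γ ∈ G ∪ H, IsRewriter mo f γ (k, 0) := by
  rcases h with h | ⟨γ, hγ, T, hT, hγT, -⟩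
  · exact h
  · obtain rfl := hT.unique (hasSig_unitVec k)
    exact ⟨γ, hγ, _, hγT, rfl, le_rfl⟩

theorem Pair.IsCovered.mono {s s' : State K n m} {p q : Pair K n m}
    (h : p.IsCovered mo f le s) (hG : s.G ⊆ s'.G) (hH : s.H ⊆ s'.H) (hP : s.P \ {q} ⊆ s'.P)
    (hq : q.IsSettled mo f le s'.G s'.H) : p.IsCovered mo f le s' := by
  rcases h with h | h | h
  · rcases eq_or_ne p q with rfl | hne
    · exact Or.inr (Or.inr hq)
    · exact Or.inl (hP ⟨h, hne⟩)
  · rcases eq_or_ne p.swap q with rfl | hne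
    · exact Or.inr (Or.inr (p.swap_swap ▸ hq.swap))
    · exact Or.inr (Or.inl (hP ⟨h, hne⟩))
  · exact Or.inr (Or.inr (h.mono hG hH))

theorem Pair.isBelowLcm_value {p : Pair K n m} (hp : p.IsCandidate mo f G)
    (hG : ∀ α ∈ G, proj f α ≠ 0) : p.IsBelowLcm mo f (proj f (p.value mo f)) := by
  cases p with
  | unit i => trivial
  | spair α β => exact isBelow_spair (hG α hp.1) (hG β hp.2.1)

theorem Pair.exists_isHom_value (hf : ∀ i, f i ≠ 0)
    (hhom : ∀ i, (f i).IsHomogeneous (f i).totalDegree) {p : Pair K n m}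
    (hp : p.IsCandidate mo f G) (hG : ∀ α ∈ G, proj f α ≠ 0) (hGhom : ∀ α ∈ G, ∃ D, IsHom f α D) :
    ∃ D, IsHom f (p.value mo f) D := by
  cases p with
  | unit i => exact ⟨_, isHom_unitVec i⟩
  | spair α β =>
    exact exists_isHom_spair hf hhom (hG α hp.1) (hG β hp.2.1) (hGhom α hp.1) (hGhom β hp.2.1)

/-! ### Signature Gröbner bases -/

/-- The part of the loop invariant of RB from which it follows that `G` is, below the signatures in
the pair set, a signature Gröbner basis. -/
structure BasisInvariant (mo : MonomialOrder (Fin n)) (f : Fin m → MvPolynomial (Fin n) K)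
    (le : FreeMod K n m → FreeMod K n m → Prop) (s : State K n m) : Prop where
  finite : s.G.Finite
  proj_ne_zero : ∀ α ∈ s.G, proj f α ≠ 0
  proj_eq_zero : ∀ σ ∈ s.H, proj f σ = 0
  irreducible : ∀ α ∈ s.G, ∀ T, HasSig mo f α T →
    ¬ IsRegularReducible mo f s.G T (mo.degree (proj f α))
  covered : ∀ p : Pair K n m, p.IsCandidate mo f s.G → p.IsCovered mo f le s

/-- The signature `T` is smaller than all signatures in the pair set. -/
def Treated (mo : MonomialOrder (Fin n)) (f : Fin m → MvPolynomial (Fin n) K)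
    (s : State K n m) (T : ModMon n m) : Prop :=
  ∀ p ∈ s.P, ∀ V, HasSig mo f (p.value mo f) V → key mo f T < key mo f V

/-- The multiples in signature `T` of elements of `G` that are not rewritable are not regular
s-reducible at the lead term. -/
def IrreducibleAt (mo : MonomialOrder (Fin n)) (f : Fin m → MvPolynomial (Fin n) K)
    (le : FreeMod K n m → FreeMod K n m → Prop) (G H : Set (FreeMod K n m))
    (T : ModMon n m) : Prop :=
  ∀ γ ∈ G, ∀ S a, HasSig mo f γ S → T = shift a S → ¬ Rewritable mo f le G H γ T →
    ¬ IsRegularReducible mo f G T (a + mo.degree (proj f γ))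

section Correctness

variable {s : State K n m}

theorem BasisInvariant.rewritable_of_syzygy (hs : BasisInvariant mo f le s)
    (hle : IsAdmissibleOrder mo f le s.G s.H) {α σ : FreeMod K n m} (hα : α ∈ s.G) (hσ : σ ∈ s.H)
    {T : ModMon n m} (hσT : IsRewriter mo f σ T) : Rewritable mo f le s.G s.H α T := by
  refine ⟨σ, Or.inr hσ, ?_, hle.le_syzygy α hα σ hσ, hσT⟩
  rintro rfl
  exact hs.proj_ne_zero σ hα (hs.proj_eq_zero σ hσ)

theorem BasisInvariant.rewritable_of_isSettled (hf : ∀ i, f i ≠ 0) (hs : BasisInvariant mo f le s)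
    (hle : IsAdmissibleOrder mo f le s.G s.H) {β γ : FreeMod K n m} (hβ : β ∈ s.G) (hγ : γ ∈ s.G)
    {S T : ModMon n m} (hS : HasSig mo f β S) (hT : HasSig mo f γ T)
    (hlt : key mo f (shift (cofactorExp mo f β γ) S) < key mo f (shift (cofactorExp mo f γ β) T))
    (h : (Pair.spair γ β).IsSettled mo f le s.G s.H) :
    Rewritable mo f le s.G s.H γ (shift (cofactorExp mo f γ β) T) ∨
      Rewritable mo f le s.G s.H β (shift (cofactorExp mo f β γ) S) := by
  have hβS := hS.cofactor_smul hf γ (hs.proj_ne_zero β hβ)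
  have hγT := hT.cofactor_smul hf β (hs.proj_ne_zero γ hγ)
  rcases h with (⟨X, hX, hrew⟩ | ⟨X, hX, hrew⟩) | ⟨δ, hδ, X, hX, hδX, hbelow⟩
  · exact Or.inl (hX.unique hγT ▸ hrew)
  · exact Or.inr (hX.unique hβS ▸ hrew)
  obtain rfl := hX.unique (hγT.sub_of_lt hβS hlt)
  have hne : T ≠ shift (cofactorExp mo f γ β) T :=
    ne_shift_cofactorExp_of_not_isRegularReducible (hs.irreducible γ hγ T hT) hβ hS hlt
  refine Or.inl ⟨δ, hδ, ?_, ?_, _, hδX, rfl, le_rfl⟩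
  · rintro rfl
    exact hne (hT.unique hδX)
  · rcases hδ with hδ | hδ
    · refine hle.le_of_dvd γ hγ δ hδ T _ hT hδX (modDvd_shift _ _) hne ?_
      have hlcm : (shift (cofactorExp mo f γ β) T).2 + mo.degree (proj f γ) =
          T.2 + (mo.degree (proj f γ) ⊔ mo.degree (proj f β)) := by
        rw [← cofactorExp_add_degree, shift, add_right_comm, add_comm]
      rw [hlcm, map_add, map_add]
      gcongr
      exact (hbelow _ (mo.degree_mem_support (hs.proj_ne_zero δ hδ))).le
    · exact hle.le_syzygy γ hγ δ hδ

theorem BasisInvariant.exists_not_rewritable_multiple (hf : ∀ i, f i ≠ 0)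
    (hs : BasisInvariant mo f le s) (hle : IsRewriteOrder le s.G s.H) {T : ModMon n m}
    (ihR : ∀ U, key mo f U < key mo f T → ReducibleAt mo f s.G U)
    (ihI : ∀ U, key mo f U < key mo f T → IrreducibleAt mo f le s.G s.H U) {u : Fin n →₀ ℕ}
    (hu : IsRegularReducible mo f s.G T u) :
    ∃ β ∈ s.G, ∃ S b, HasSig mo f β S ∧ b + mo.degree (proj f β) = u ∧
      key mo f (shift b S) < key mo f T ∧ ¬ Rewritable mo f le s.G s.H β (shift b S) := by
  -- A multiple of minimal signature cannot be reduced further, so its canonical rewriter also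
  -- has the lead monomial `x^u`.
  obtain ⟨V, ⟨hVT, hV⟩, hmin⟩ := (InvImage.wf (key mo f) wellFounded_lt).has_min
    {V | key mo f V < key mo f T ∧ IsMultiple mo f s.G u V} hu
  have hirr : ¬ IsRegularReducible mo f s.G V u := fun ⟨U, hUV, hU⟩ =>
    hmin U ⟨hUV.trans hVT, hU⟩ hUV
  have ihRV : ∀ U, key mo f U < key mo f V → ReducibleAt mo f s.G U :=
    fun U hU => ihR U (hU.trans hVT)
  obtain ⟨α, hα, R, w, hR, rfl, rfl⟩ := hV
  have hα0 := hs.proj_ne_zero α hα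
  have hsig := hR.monomial_smul hf w (one_ne_zero (α := K))
  have hdeg := degree_proj_monomial_smul hα0 w (mo := mo) (one_ne_zero (α := K))
  have hproj : proj f (monomial w (1 : K) • α) ≠ 0 := by
    rw [proj_smul]
    exact mul_ne_zero (monomial_eq_zero.not.2 one_ne_zero) hα0
  rw [← hdeg] at hirr ⊢
  obtain ⟨β, hβ, ⟨S, hS, hSV⟩, hrew⟩ := hle.exists_not_rewritable hs.finite
    ⟨α, Or.inl hα, R, hR, modDvd_shift w R⟩ fun σ hσ hσV =>
      hirr (hsig.isRegularReducible_of_syzygy hf ihRV hproj hσV (hs.proj_eq_zero σ hσ))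
  obtain ⟨b, hb⟩ := modDvd_iff_exists_shift.1 hSV
  rw [hb] at hirr hsig hVT hrew ihRV
  rcases hsig.degree_eq_or_isRegularReducible hf ihRV hS (hs.proj_ne_zero β hβ) with h | h | h
  · exact ⟨β, hβ, S, b, hS, h, hVT, hrew⟩
  · exact absurd h hirr
  · exact absurd h (ihI _ hVT β hβ S b hS rfl hrew)

/- The S-pair of `γ` and of the basis element whose multiple reduces that of `γ` has left the pair
set. Being settled, it makes one of its two generators rewritable, but neither multiple is. -/
theorem BasisInvariant.irreducibleAt_of_treated (hf : ∀ i, f i ≠ 0)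
    (hs : BasisInvariant mo f le s) (hle : IsAdmissibleOrder mo f le s.G s.H) {T : ModMon n m}
    (hT : Treated mo f s T) (ihR : ∀ U, key mo f U < key mo f T → ReducibleAt mo f s.G U)
    (ihI : ∀ U, key mo f U < key mo f T → IrreducibleAt mo f le s.G s.H U) :
    IrreducibleAt mo f le s.G s.H T := by
  intro γ hγ R a hR hTR hγrew hred
  obtain ⟨β, hβ, S, b, hS, hdeg, hlt, hβrew⟩ :=
    hs.exists_not_rewritable_multiple hf hle.toIsRewriteOrder ihR ihI hred
  obtain ⟨r, rfl, rfl⟩ := exists_eq_add_cofactorExp hdeg.symm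
  subst hTR
  rw [shift_add] at hT hγrew hlt hβrew
  rw [shift_add, key_shift_lt_iff hf] at hlt
  have hβS := hS.cofactor_smul hf γ (hs.proj_ne_zero β hβ)
  have hγR := hR.cofactor_smul hf β (hs.proj_ne_zero γ hγ)
  have hpair : HasSig mo f ((Pair.spair γ β).value mo f) _ := hγR.sub_of_lt hβS hlt
  rcases hs.covered (.spair γ β) ⟨hγ, hβ, _, _, hγR, hβS, fun h => hlt.ne' (congrArg _ h)⟩ with
    h | h | h
  · exact (hT _ h _ hpair).not_ge (key_le_key_shift hf _ _)
  · exact (hT _ h _ (Pair.hasSig_value_swap hpair)).not_ge (key_le_key_shift hf _ _)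
  · rcases hs.rewritable_of_isSettled hf hle hβ hγ hS hR hlt h with h | h
    · exact hγrew (h.of_modDvd (modDvd_shift _ _))
    · exact hβrew (h.of_modDvd (modDvd_shift _ _))

theorem BasisInvariant.exists_isRewriter_of_treated (hf : ∀ i, f i ≠ 0)
    (hs : BasisInvariant mo f le s) {T : ModMon n m} (hT : Treated mo f s T) :
    ∃ γ ∈ s.G ∪ s.H, IsRewriter mo f γ T := by
  have hnotMem : Pair.unit T.1 ∉ s.P := fun h =>
    (hT _ h _ (hasSig_unitVec T.1)).not_ge
      (by simpa only [shift_snd_fst_zero] using key_le_key_shift hf T.2 (T.1, 0))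
  obtain ⟨γ, hγ, S, hS, hST⟩ := Pair.IsSettled.exists_isRewriter_of_unit
    (((hs.covered (.unit T.1) trivial).resolve_left hnotMem).resolve_left hnotMem)
  exact ⟨γ, hγ, S, hS, hST.trans ⟨rfl, zero_le⟩⟩

theorem BasisInvariant.reducibleAt_of_irreducibleAt (hf : ∀ i, f i ≠ 0)
    (hs : BasisInvariant mo f le s) (hle : IsRewriteOrder le s.G s.H) {T : ModMon n m}
    (hT : Treated mo f s T) (ihR : ∀ U, key mo f U < key mo f T → ReducibleAt mo f s.G U)
    (hI : IrreducibleAt mo f le s.G s.H T) : ReducibleAt mo f s.G T := by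
  intro α hα hα0
  suffices h : IsMultiple mo f s.G (mo.degree (proj f α)) T ∨
      IsRegularReducible mo f s.G T (mo.degree (proj f α)) from
    h.elim (fun h => ⟨T, le_rfl, h⟩) fun ⟨V, hV, h⟩ => ⟨V, hV.le, h⟩
  by_cases hH : ∃ σ ∈ s.H, IsRewriter mo f σ T
  · obtain ⟨σ, hσ, hσT⟩ := hH
    exact Or.inr (hα.isRegularReducible_of_syzygy hf ihR hα0 hσT (hs.proj_eq_zero σ hσ))
  · push Not at hH
    obtain ⟨γ, hγ, ⟨S, hS, hST⟩, hrew⟩ :=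
      hle.exists_not_rewritable hs.finite (hs.exists_isRewriter_of_treated hf hT) hH
    obtain ⟨w, rfl⟩ := modDvd_iff_exists_shift.1 hST
    rcases hα.degree_eq_or_isRegularReducible hf ihR hS (hs.proj_ne_zero γ hγ) with h | h | h
    · exact Or.inl ⟨γ, hγ, S, w, hS, h, rfl⟩
    · exact Or.inr h
    · exact absurd h (hI γ hγ S w hS rfl hrew)

theorem BasisInvariant.reducibleAt (hf : ∀ i, f i ≠ 0) (hs : BasisInvariant mo f le s)
    (hle : IsAdmissibleOrder mo f le s.G s.H) {T : ModMon n m} (hT : Treated mo f s T) :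
    ReducibleAt mo f s.G T := by
  suffices h : ReducibleAt mo f s.G T ∧ IrreducibleAt mo f le s.G s.H T from h.1
  induction T using key_induction (mo := mo) (f := f) with
  | ih T ih =>
    have ih' : ∀ U, key mo f U < key mo f T →
        ReducibleAt mo f s.G U ∧ IrreducibleAt mo f le s.G s.H U :=
      fun U hU => ih U hU fun p hp V hV => hU.trans (hT p hp V hV)
    have hI := hs.irreducibleAt_of_treated hf hle hT (fun U hU => (ih' U hU).1)
      fun U hU => (ih' U hU).2
    exact ⟨hs.reducibleAt_of_irreducibleAt hf hle.toIsRewriteOrder hT (fun U hU => (ih' U hU).1) hI,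
      hI⟩

end Correctness

/-! ### Regular s-reduction -/

theorem RegularStep.hasSig {α α' : FreeMod K n m} {T : ModMon n m}
    (h : RegularStep mo f G α α') (hα : HasSig mo f α T) : HasSig mo f α' T := by
  obtain ⟨β, -, w, c, -, -, ⟨S, T', hS, hT', hlt⟩, rfl⟩ := h
  obtain rfl := hα.unique hT'
  exact hα.sub_of_lt hS (dPotLT_iff_key_lt.1 hlt)

theorem RegularStep.exists_degree_mem_support {α α' : FreeMod K n m}
    (h : RegularStep mo f G α α') :
    ∃ β ∈ G, ∃ (w : Fin n →₀ ℕ) (c : K), c ≠ 0 ∧ α' = α - monomial w c • β ∧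
      mo.degree (proj f (monomial w c • β)) ∈ (proj f α).support := by
  classical
  obtain ⟨β, hβ, w, c, hc, ⟨v, hv, hlead⟩, -, rfl⟩ := h
  refine ⟨β, hβ, w, c, hc, rfl, ?_⟩
  rwa [← mo.degree_leadingTerm, hlead, mo.degree_monomial, if_neg (mem_support_iff.1 hv)]

theorem RegularStep.isBelow {α α' : FreeMod K n m} (h : RegularStep mo f G α α')
    {u : Fin n →₀ ℕ} (hα : IsBelow mo (proj f α) u) : IsBelow mo (proj f α') u := by
  obtain ⟨β, -, w, c, -, rfl, hmem⟩ := h.exists_degree_mem_support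
  rw [proj_sub]
  exact hα.sub fun v hv => (mo.le_degree hv).trans_lt (hα _ hmem)

theorem RegularStep.isHom (hf : ∀ i, f i ≠ 0)
    (hhom : ∀ i, (f i).IsHomogeneous (f i).totalDegree) (hG : ∀ α ∈ G, proj f α ≠ 0)
    (hGhom : ∀ α ∈ G, ∃ D, IsHom f α D) {α α' : FreeMod K n m} (h : RegularStep mo f G α α')
    {D : ℕ} (hα : IsHom f α D) : IsHom f α' D := by
  obtain ⟨β, hβ, w, c, hc, rfl, hmem⟩ := h.exists_degree_mem_support
  obtain ⟨E, hE⟩ := hGhom β hβ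
  have hdeg : w.degree + E = D := by
    rw [← hα.degree_eq_of_mem_support hf hhom hmem, degree_proj_monomial_smul (hG β hβ) w hc,
      map_add, hE.degree_eq_of_mem_support hf hhom (mo.degree_mem_support (hG β hβ))]
  exact hα.sub (hdeg ▸ hE.monomial_smul hf w c)

theorem RegularResult.induction {motive : FreeMod K n m → Prop} {α γ : FreeMod K n m}
    (h : RegularResult mo f G α γ) (init : motive α)
    (step : ∀ β β', RegularStep mo f G β β' → motive β → motive β') : motive γ := by
  obtain ⟨h, -⟩ := h
  induction h with
  | refl => exact init
  | tail _ h ih => exact step _ _ h ih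

theorem RegularResult.not_isRegularReducible (hf : ∀ i, f i ≠ 0) (hG : ∀ α ∈ G, proj f α ≠ 0)
    {α γ : FreeMod K n m} (h : RegularResult mo f G α γ) {T : ModMon n m}
    (hT : HasSig mo f γ T) (h0 : proj f γ ≠ 0) :
    ¬ IsRegularReducible mo f G T (mo.degree (proj f γ)) := by
  rintro ⟨V, hlt, β, hβ, S, w, hS, hw, rfl⟩
  have hβ0 := mo.leadingCoeff_ne_zero_iff.2 (hG β hβ)
  have hc : mo.leadingCoeff (proj f γ) / mo.leadingCoeff (proj f β) ≠ 0 :=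
    div_ne_zero (mo.leadingCoeff_ne_zero_iff.2 h0) hβ0
  refine h.2 ⟨_, β, hβ, w, _, hc, ⟨mo.degree (proj f γ), mo.degree_mem_support h0, ?_⟩,
    ⟨_, T, hS.monomial_smul hf w hc, hT, dPotLT_iff_key_lt.2 hlt⟩, rfl⟩
  rw [MonomialOrder.leadingTerm, degree_proj_monomial_smul (hG β hβ) w hc, hw, proj_smul,
    mo.leadingCoeff_mul, mo.leadingCoeff_monomial, div_mul_cancel₀ _ hβ0]
  rfl

theorem RegularResult.isBelowLcm {p : Pair K n m} {γ : FreeMod K n m}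
    (h : RegularResult mo f G (p.value mo f) γ) (hp : p.IsCandidate mo f G)
    (hG : ∀ α ∈ G, proj f α ≠ 0) : p.IsBelowLcm mo f (proj f γ) := by
  refine h.induction (motive := fun γ => p.IsBelowLcm mo f (proj f γ))
    (Pair.isBelowLcm_value hp hG) fun β β' hstep hβ => ?_
  cases p with
  | unit i => trivial
  | spair α α' => exact hstep.isBelow hβ

/-! ### The loop invariant -/

/-- The loop invariant of RB. The syzygies in `koszul`, which come from the basis elements of
earlier degree steps, are those by which the pairs that would be reduced to zero are discarded. -/
structure Invariant (mo : MonomialOrder (Fin n)) (f : Fin m → MvPolynomial (Fin n) K)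
    (le : FreeMod K n m → FreeMod K n m → Prop) (s : State K n m) : Prop
    extends BasisInvariant mo f le s where
  isHom : ∀ α ∈ s.G, ∃ D, IsHom f α D
  isCandidate : ∀ p ∈ s.P, p.IsCandidate mo f s.G
  key_le : ∀ p ∈ s.P, ∀ T, HasSig mo f (p.value mo f) T → ∀ α ∈ s.G, ∀ S, HasSig mo f α S →
    key mo f S ≤ key mo f T
  deg_le : ∀ p ∈ s.P, ∀ T, HasSig mo f (p.value mo f) T → s.deg ≤ sigDegree f T
  koszul : ∀ α ∈ s.G, ∀ S, HasSig mo f α S → sigDegree f S < s.deg → ∀ k, S.1 < k →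
    proj f α • unitVec k - f k • α ∈ s.H

theorem Pair.IsCandidate.mono {p : Pair K n m} (h : p.IsCandidate mo f G) (hG : G ⊆ G') :
    p.IsCandidate mo f G' := by
  cases p with
  | unit i => trivial
  | spair α β => exact ⟨hG h.1, hG h.2.1, h.2.2⟩

theorem IsRegularPair.symm {α β : FreeMod K n m} (h : IsRegularPair mo f α β) :
    IsRegularPair mo f β α := by
  obtain ⟨S, T, hS, hT, hne⟩ := h
  exact ⟨T, S, hT, hS, hne.symm⟩

theorem not_isRegularPair_self (α : FreeMod K n m) : ¬ IsRegularPair mo f α α :=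
  fun ⟨_, _, hS, hT, hne⟩ => hne (hS.unique hT)

theorem IsNext.key_le {s : State K n m} {p q : Pair K n m} {T U : ModMon n m}
    (hp : IsNext mo f s p T) (hq : q ∈ s.P) (hU : HasSig mo f (q.value mo f) U) :
    key mo f T ≤ key mo f U :=
  not_lt.1 fun h => hp.2.2 q hq U hU (dPotLT_iff_key_lt.2 h)

section LoopInvariant

variable {s s' : State K n m} {p : Pair K n m} {γ : FreeMod K n m}

theorem Reduces.isSettled (hs : Invariant mo f le s) (h : Reduces mo f le s p γ)
    (hγ : γ ∈ G ∪ H) : p.IsSettled mo f le G H := by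
  obtain ⟨⟨T, hT, -⟩, -, hresult⟩ := h
  exact Or.inr ⟨γ, hγ, T, hT.2.1, hresult.induction hT.2.1 fun _ _ hstep => hstep.hasSig,
    hresult.isBelowLcm (hs.isCandidate p hT.1) hs.proj_ne_zero⟩

theorem Reduces.exists_isHom (hf : ∀ i, f i ≠ 0)
    (hhom : ∀ i, (f i).IsHomogeneous (f i).totalDegree) (hs : Invariant mo f le s)
    (h : Reduces mo f le s p γ) : ∃ D, IsHom f γ D := by
  obtain ⟨⟨T, hT, -⟩, -, hresult⟩ := h
  obtain ⟨D, hD⟩ := Pair.exists_isHom_value hf hhom (hs.isCandidate p hT.1) hs.proj_ne_zero hs.isHom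
  exact ⟨D, hresult.induction hD fun _ _ hstep => hstep.isHom hf hhom hs.proj_ne_zero hs.isHom⟩

theorem Reduces.exists_hasSig (hs : Invariant mo f le s) (h : Reduces mo f le s p γ) :
    ∃ T, IsNext mo f s p T ∧ sigDegree f T = s.deg ∧ HasSig mo f γ T := by
  obtain ⟨⟨T, hT, hdeg⟩, -, hresult⟩ := h
  exact ⟨T, hT, hdeg.antisymm (hs.deg_le p hT.1 T hT.2.1),
    hresult.induction hT.2.1 fun _ _ hstep => hstep.hasSig⟩

theorem key_le_of_hasSig_spair (hf : ∀ i, f i ≠ 0) {T : ModMon n m} (hT : HasSig mo f γ T)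
    {α : FreeMod K n m} (h : IsRegularPair mo f α γ) {U : ModMon n m}
    (hU : HasSig mo f ((Pair.spair α γ).value mo f) U) : key mo f T ≤ key mo f U := by
  have hle : ∀ V, HasSig mo f (cofactor mo f γ α • γ) V → key mo f T ≤ key mo f V := by
    intro V hV
    obtain ⟨S, hS, rfl⟩ := hV.exists_of_cofactor_smul hf
    exact hT.unique hS ▸ key_le_key_shift hf _ _
  rcases h.hasSig_generator hU with ⟨-, V, hV, hlt⟩ | ⟨hγU, -⟩
  · exact (hle V hV).trans hlt.le
  · exact hle U hγU

theorem invariant_initState : Invariant mo f le (initState f) where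
  finite := Set.finite_empty
  proj_ne_zero _ h := absurd h (Set.notMem_empty _)
  proj_eq_zero := by
    rintro σ ⟨i, j, -, rfl⟩
    rw [proj_sub, proj_smul, proj_smul, proj_unitVec, proj_unitVec, mul_comm, sub_self]
  irreducible _ h := absurd h (Set.notMem_empty _)
  covered
    | .unit k, _ => Or.inl ⟨k, rfl⟩
    | .spair _ _, h => absurd h.1 (Set.notMem_empty _)
  isHom _ h := absurd h (Set.notMem_empty _)
  isCandidate := by
    rintro p ⟨k, rfl⟩
    trivial
  key_le _ _ _ _ _ h := absurd h (Set.notMem_empty _)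
  deg_le _ _ _ _ := Nat.zero_le _
  koszul _ h := absurd h (Set.notMem_empty _)

theorem Invariant.newDegree (hs : Invariant mo f le s) {T : ModMon n m}
    (hp : IsNext mo f s p T) :
    Invariant mo f le { s with H := s.H ∪ basisKoszul mo f s.G, deg := sigDegree f T } :=
  { hs with
    proj_eq_zero := by
      rintro σ (hσ | ⟨α, -, S, -, k, -, rfl⟩)
      · exact hs.proj_eq_zero σ hσ
      · rw [← proj_unitVec (f := f) k]
        exact proj_smul_sub_smul α _
    covered := fun q hq => (hs.covered q hq).imp_right
      (Or.imp_right (·.mono subset_rfl Set.subset_union_left))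
    deg_le := fun q hq U hU => sigDegree_le_of_key_le (hp.key_le hq hU)
    koszul := fun α hα S hS _ k hk => Or.inr ⟨α, hα, S, hS, k, hk, rfl⟩ }

theorem Invariant.discard (hs : Invariant mo f le s) (hr : p.IsRewritable mo f le s.G s.H) :
    Invariant mo f le { s with P := s.P \ {p} } :=
  { hs with
    covered := fun q hq =>
      (hs.covered q hq).mono subset_rfl subset_rfl subset_rfl (Or.inl hr)
    isCandidate := fun q hq => hs.isCandidate q hq.1
    key_le := fun q hq => hs.key_le q hq.1
    deg_le := fun q hq => hs.deg_le q hq.1 }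

theorem Invariant.syzygy (hs : Invariant mo f le s) (hp : Reduces mo f le s p γ)
    (h0 : proj f γ = 0) : Invariant mo f le { s with P := s.P \ {p}, H := s.H ∪ {γ} } :=
  { hs with
    proj_eq_zero := by
      rintro σ (hσ | rfl)
      · exact hs.proj_eq_zero σ hσ
      · exact h0
    covered := fun q hq => (hs.covered q hq).mono subset_rfl Set.subset_union_left subset_rfl
      (hp.isSettled hs (Or.inr (Or.inr rfl)))
    isCandidate := fun q hq => hs.isCandidate q hq.1
    key_le := fun q hq => hs.key_le q hq.1
    deg_le := fun q hq => hs.deg_le q hq.1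
    koszul := fun α hα S hS hd k hk => Or.inl (hs.koszul α hα S hS hd k hk) }

theorem not_isRegularReducible_union (hf : ∀ i, f i ≠ 0) {A : Set (FreeMod K n m)}
    {T : ModMon n m} {u : Fin n →₀ ℕ} (h : ¬ IsRegularReducible mo f G T u)
    (hA : ∀ α ∈ A, ∀ S, HasSig mo f α S → key mo f T ≤ key mo f S) :
    ¬ IsRegularReducible mo f (G ∪ A) T u := by
  rintro ⟨V, hV, β, hβ | hβ, S, w, hS, hu, rfl⟩
  · exact h ⟨_, hV, β, hβ, S, w, hS, hu, rfl⟩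
  · exact ((hA β hβ S hS).trans (key_le_key_shift hf w S)).not_gt hV

/-- The state that RB reaches from `s` by adding the result `γ` of reducing `p` to the basis. -/
def State.addBasis (mo : MonomialOrder (Fin n)) (f : Fin m → MvPolynomial (Fin n) K)
    (s : State K n m) (p : Pair K n m) (γ : FreeMod K n m) : State K n m :=
  { s with
    P := (s.P \ {p}) ∪ {q | ∃ α ∈ s.G, IsRegularPair mo f α γ ∧ q = Pair.spair α γ}
    G := s.G ∪ {γ} }

theorem Invariant.isCovered_addBasis (hs : Invariant mo f le s) (hp : Reduces mo f le s p γ)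
    {q : Pair K n m} (hq : q.IsCandidate mo f (s.G ∪ {γ})) :
    q.IsCovered mo f le (s.addBasis mo f p γ) := by
  have hold (hq : q.IsCandidate mo f s.G) : q.IsCovered mo f le (s.addBasis mo f p γ) :=
    (hs.covered q hq).mono Set.subset_union_left subset_rfl Set.subset_union_left
      (hp.isSettled hs (Or.inl (Or.inr rfl)))
  match q, hq with
  | .unit _, _ => exact hold trivial
  | .spair α β, ⟨Or.inl hα, Or.inl hβ, hreg⟩ => exact hold ⟨hα, hβ, hreg⟩
  | .spair α _, ⟨Or.inl hα, Or.inr rfl, hreg⟩ => exact Or.inl (Or.inr ⟨α, hα, hreg, rfl⟩)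
  | .spair _ β, ⟨Or.inr rfl, Or.inl hβ, hreg⟩ =>
    exact Or.inr (Or.inl (Or.inr ⟨β, hβ, hreg.symm, rfl⟩))
  | .spair _ _, ⟨Or.inr rfl, Or.inr rfl, hreg⟩ => exact absurd hreg (not_isRegularPair_self _)

theorem Invariant.addBasis (hf : ∀ i, f i ≠ 0)
    (hhom : ∀ i, (f i).IsHomogeneous (f i).totalDegree) (hs : Invariant mo f le s)
    (hp : Reduces mo f le s p γ) (h0 : proj f γ ≠ 0) :
    Invariant mo f le (s.addBasis mo f p γ) := by
  obtain ⟨T, hT, hdeg, hγT⟩ := hp.exists_hasSig hs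
  have hγirr := hp.2.2.not_isRegularReducible hf hs.proj_ne_zero hγT h0
  have hkeyγ : ∀ α ∈ s.G ∪ {γ}, ∀ S, HasSig mo f α S → key mo f S ≤ key mo f T := by
    rintro α (hα | rfl) S hS
    · exact hs.key_le p hT.1 T hT.2.1 α hα S hS
    · rw [hS.unique hγT]
  have hkey : ∀ q ∈ (s.addBasis mo f p γ).P, ∀ U, HasSig mo f (q.value mo f) U →
      key mo f T ≤ key mo f U := by
    rintro q (hq | ⟨α, -, hreg, rfl⟩) U hU
    · exact hT.key_le hq.1 hU
    · exact key_le_of_hasSig_spair hf hγT hreg hU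
  refine
    { finite := hs.finite.union (Set.finite_singleton γ)
      proj_ne_zero := fun α hα => hα.elim (hs.proj_ne_zero α) fun h => h ▸ h0
      proj_eq_zero := hs.proj_eq_zero
      irreducible := fun α hα S hS => not_isRegularReducible_union hf ?_ ?_
      covered := fun q hq => hs.isCovered_addBasis hp hq
      isHom := fun α hα => hα.elim (hs.isHom α) fun h => h ▸ hp.exists_isHom hf hhom hs
      isCandidate := ?_
      key_le := fun q hq U hU α hα S hS => (hkeyγ α hα S hS).trans (hkey q hq U hU)
      deg_le := fun q hq U hU => hdeg.ge.trans (sigDegree_le_of_key_le (hkey q hq U hU))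
      koszul := ?_ }
  · rcases hα with hα | rfl
    · exact hs.irreducible α hα S hS
    · exact hS.unique hγT ▸ hγirr
  · rintro _ rfl U hU
    exact hU.unique hγT ▸ hkeyγ α hα S hS
  · rintro q (hq | ⟨α, hα, hreg, rfl⟩)
    · exact (hs.isCandidate q hq.1).mono Set.subset_union_left
    · exact ⟨Or.inl hα, Or.inr rfl, hreg⟩
  · rintro α (hα | rfl) S hS hlt k hk
    · exact hs.koszul α hα S hS hlt k hk
    · exact absurd (hS.unique hγT ▸ hdeg) hlt.ne

theorem Invariant.of_step (hf : ∀ i, f i ≠ 0)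
    (hhom : ∀ i, (f i).IsHomogeneous (f i).totalDegree) (hs : Invariant mo f le s)
    (h : Step mo f le s s') : Invariant mo f le s' := by
  cases h with
  | newDegree p T hp hd => exact hs.newDegree hp
  | discard p T hp hd hr => exact hs.discard hr
  | syzygy p γ hp h0 => exact hs.syzygy hp h0
  | basis p γ hp h0 => exact hs.addBasis hf hhom hp h0

theorem IsRun.invariant (hf : ∀ i, f i ≠ 0)
    (hhom : ∀ i, (f i).IsHomogeneous (f i).totalDegree) {N : ℕ} {s : ℕ → State K n m}
    (h : IsRun mo f le N s) : ∀ i ≤ N, Invariant mo f le (s i) := by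
  intro i
  induction i with
  | zero => exact fun _ => h.init ▸ invariant_initState
  | succ i ih => exact fun hi => (ih (by omega)).of_step hf hhom (h.step i (by omega))

end LoopInvariant

/-! ### Syzygies of a regular sequence -/

theorem IsHom.apply_mem_span_of_proj_eq_zero
    (hreg : RingTheory.Sequence.IsRegular (MvPolynomial (Fin n) K) (List.ofFn f))
    {γ : FreeMod K n m} {D : ℕ} (hγ : IsHom f γ D) (h0 : proj f γ = 0) {T : ModMon n m}
    (hT : HasSig mo f γ T) : γ T.1 ∈ Ideal.span (f '' Set.Iio T.1) := by
  refine mem_span_of_isRegular_of_mul_mem hreg ?_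
  have hsum : γ T.1 * f T.1 = -∑ i ∈ Finset.univ.erase T.1, γ i * f i := by
    rw [eq_neg_iff_add_eq_zero, Finset.add_sum_erase _ (fun i => γ i * f i) (Finset.mem_univ _)]
    exact h0
  rw [hsum]
  refine neg_mem (Ideal.sum_mem _ fun i hi => ?_)
  by_cases hγi : γ i = 0
  · rw [hγi, zero_mul]
    exact Ideal.zero_mem _
  · exact Ideal.mul_mem_left _ _ (Ideal.subset_span
      ⟨i, (hγ.index_le hT hγi).lt_of_ne (Finset.ne_of_mem_erase hi), rfl⟩)

theorem exists_isHom_proj_eq (hf : ∀ i, f i ≠ 0)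
    (hhom : ∀ i, (f i).IsHomogeneous (f i).totalDegree) {k : Fin m} {g : MvPolynomial (Fin n) K}
    (hg : g ∈ Ideal.span (f '' Set.Iio k)) {E : ℕ} (hgE : g.IsHomogeneous E) :
    ∃ α : FreeMod K n m, (∀ i, α i ≠ 0 → i < k) ∧ IsHom f α E ∧ proj f α = g := by
  rw [← Finset.coe_Iio, Ideal.span, Submodule.mem_span_image_finset_iff_exists_fun'] at hg
  obtain ⟨c, hc⟩ := hg
  refine ⟨fun i => if i < k ∧ (f i).totalDegree ≤ E then
    homogeneousComponent (E - (f i).totalDegree) (c i) else 0, fun i hi => ?_, fun ⟨i, a⟩ ha => ?_,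
    ?_⟩
  · by_contra hik
    exact hi (if_neg fun h => hik h.1)
  · dsimp only at ha
    split_ifs at ha with h
    · rw [coeff_homogeneousComponent] at ha
      have hdeg : a.degree = E - (f i).totalDegree := by
        by_contra hne
        exact ha (if_neg hne)
      rw [sigDegree_eq hf, hdeg]
      exact Nat.sub_add_cancel h.2
    · exact absurd (coeff_zero a) ha
  · rw [← homogeneousComponent_eq_self hgE, ← hc, map_sum, proj,
      ← Finset.sum_subset (Finset.subset_univ (Finset.Iio k)) fun i _ hi => ?_]
    · refine Finset.sum_congr rfl fun i hi => ?_
      rw [smul_eq_mul, homogeneousComponent_mul_of_isHomogeneous (hhom i), ite_mul, zero_mul]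
      simp only [Finset.mem_Iio.1 hi, true_and]
    · rw [if_neg fun h => hi (Finset.mem_Iio.2 h.1), zero_mul]

/-! ### No s-reduction to zero -/

section NoReductionToZero

variable {s : State K n m}

theorem Invariant.exists_degree_le_of_mem_span (hf : ∀ i, f i ≠ 0)
    (hhom : ∀ i, (f i).IsHomogeneous (f i).totalDegree) (hs : Invariant mo f le s)
    (hle : IsAdmissibleOrder mo f le s.G s.H) {k : Fin m} {g : MvPolynomial (Fin n) K}
    (hg : g ∈ Ideal.span (f '' Set.Iio k)) (hg0 : g ≠ 0) {E : ℕ} (hgE : g.IsHomogeneous E)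
    (hE : E < s.deg) :
    ∃ β ∈ s.G, ∃ S, HasSig mo f β S ∧ S.1 < k ∧ sigDegree f S < s.deg ∧
      mo.degree (proj f β) ≤ mo.degree g := by
  obtain ⟨α, hα, hαE, rfl⟩ := exists_isHom_proj_eq hf hhom hg hgE
  obtain ⟨U, hU⟩ := exists_hasSig_of_proj_ne_zero (mo := mo) hg0
  have hUdeg : sigDegree f U = E := hαE U hU.1
  have htreated : Treated mo f s U := fun q hq V hV =>
    key_lt_of_sigDegree_lt (hUdeg.trans_lt (hE.trans_le (hs.deg_le q hq V hV)))
  obtain ⟨_, hVU, β, hβ, S, w, hS, hw, rfl⟩ := hs.reducibleAt hf hle htreated α hU hg0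
  have hSdeg : sigDegree f (shift w S) = E := by
    obtain ⟨D, hD⟩ := hs.isHom β hβ
    rw [sigDegree_shift hf, hD S hS.1,
      ← hD.degree_eq_of_mem_support hf hhom (mo.degree_mem_support (hs.proj_ne_zero β hβ)),
      ← map_add, hw]
    exact hαE.degree_eq_of_mem_support hf hhom (mo.degree_mem_support hg0)
  have hindex : S.1 ≤ U.1 :=
    ((key_le_iff_of_sigDegree_eq (hSdeg.trans hUdeg.symm)).1 hVU).elim le_of_lt fun h => h.1.le
  refine ⟨β, hβ, S, hS, hindex.trans_lt (hα _ hU.apply_ne_zero), ?_, hw ▸ le_add_self⟩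
  rw [sigDegree_shift hf] at hSdeg
  omega

theorem Invariant.exists_isRewriter_of_syzygy
    (hreg : RingTheory.Sequence.IsRegular (MvPolynomial (Fin n) K) (List.ofFn f))
    (hhom : ∀ i, (f i).IsHomogeneous (f i).totalDegree) (hs : Invariant mo f le s)
    (hle : IsAdmissibleOrder mo f le s.G s.H) {γ : FreeMod K n m} {D : ℕ} (hγ : IsHom f γ D)
    (h0 : proj f γ = 0) {T : ModMon n m} (hT : HasSig mo f γ T) (hdeg : sigDegree f T = s.deg) :
    ∃ σ ∈ s.H, IsRewriter mo f σ T := by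
  have hf := ne_zero_of_isRegular hreg
  have hcomp : (γ T.1).IsHomogeneous (D - (f T.1).totalDegree) := hγ.isHomogeneous_apply hf T.1
  have hlt : D - (f T.1).totalDegree < s.deg := by
    have hpos := totalDegree_pos_of_not_isUnit (hf T.1) (not_isUnit_of_isRegular hreg T.1)
    have hD := hγ T hT.1
    rw [sigDegree_eq hf] at hdeg hD
    omega
  obtain ⟨β, hβ, S, hS, hST, hSdeg, hdvd⟩ := hs.exists_degree_le_of_mem_span hf hhom hle
    (hγ.apply_mem_span_of_proj_eq_zero hreg h0 hT) hT.apply_ne_zero hcomp hlt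
  obtain ⟨E, hE⟩ := hs.isHom β hβ
  rw [hγ.degree_apply_eq hT] at hdvd
  exact ⟨_, hs.koszul β hβ S hS hSdeg T.1 hST, _,
    hasSig_koszul hf hhom hE hS (hs.proj_ne_zero β hβ) hST, rfl, hdvd⟩

theorem Invariant.isRewritable_of_isRewriter (hs : Invariant mo f le s)
    (hle : IsAdmissibleOrder mo f le s.G s.H) {p : Pair K n m} (hp : p ∈ s.P) {T : ModMon n m}
    (hT : HasSig mo f (p.value mo f) T) {σ : FreeMod K n m} (hσ : σ ∈ s.H)
    (hσT : IsRewriter mo f σ T) : p.IsRewritable mo f le s.G s.H := by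
  have hcand := hs.isCandidate p hp
  cases p with
  | unit k => exact ⟨σ, Or.inr hσ, hT.unique (hasSig_unitVec k) ▸ hσT⟩
  | spair α β =>
    obtain ⟨hα, hβ, hreg⟩ := hcand
    rcases hreg.hasSig_generator hT with ⟨hαT, -⟩ | ⟨hβT, -⟩
    · exact Or.inl ⟨T, hαT, hs.rewritable_of_syzygy hle hα hσ hσT⟩
    · exact Or.inr ⟨T, hβT, hs.rewritable_of_syzygy hle hβ hσ hσT⟩

end NoReductionToZero

end SigGB

theorem mainTheorem3 {K : Type*} [Field K] {n m : ℕ} (mo : MonomialOrder (Fin n))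
    (f : Fin m → MvPolynomial (Fin n) K)
    (hhom : ∀ i, ∃ d, (f i).IsHomogeneous d)
    (hreg : RingTheory.Sequence.IsRegular (MvPolynomial (Fin n) K) (List.ofFn f))
    (le : SigGB.FreeMod K n m → SigGB.FreeMod K n m → Prop)
    (N : ℕ) (s : ℕ → SigGB.State K n m) (hrun : SigGB.IsRun mo f le N s) :
    ∀ i ≤ N, ∀ (p : SigGB.Pair K n m) (γ : SigGB.FreeMod K n m),
      SigGB.Reduces mo f le (s i) p γ → SigGB.proj f γ ≠ 0 := by
  intro i hi p γ hp h0
  have hf := SigGB.ne_zero_of_isRegular hreg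
  have hhom' : ∀ i, (f i).IsHomogeneous (f i).totalDegree := fun i => by
    obtain ⟨d, hd⟩ := hhom i
    rwa [hd.totalDegree (hf i)]
  have hle := hrun.order i hi
  have hs := hrun.invariant hf hhom' i hi
  obtain ⟨D, hγ⟩ := hp.exists_isHom hf hhom' hs
  obtain ⟨T, hT, hdeg, hγT⟩ := hp.exists_hasSig hs
  obtain ⟨σ, hσ, hσT⟩ := hs.exists_isRewriter_of_syzygy hreg hhom' hle hγ h0 hγT hdeg
  exact hp.2.1 (hs.isRewritable_of_isRewriter hle hT.1 hT.2.1 hσ hσT)
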